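/- Let $R$ be a finite commutative local ring with maximal ideal $\mathfrak m$, let $u\in\mathbb Z$ and $\varepsilon>0$. Let $\xi$ be an $R$-valued random variable whose distribution is not concentrated on a translate $a+I$ of a proper ideal $I\subsetneq R$, and is not concentrated on a set $a+cS$ with $a\in R$, $c\in R^*$ and $S\subsetneq R$ a proper subring (that is, no unit multiple of $\xi$ is concentrated on a translate of a proper subring). For $l,k\ge 0$ with $k=l+u$ let $\mathcal M_{l,k}$ be the random $l\times k$ matrix over $R$ whose entries are independent copies of $\xi$, regarded as a map $R^k\to R^l$. For a signed measure $\nu$ on $R^l$ and a submodule $N\subset R^l$ let $\mathrm{proj}_N\nu$ be the average of $\nu$ over $N$-cosets, $(\mathrm{proj}_N\nu)(x)=\frac1{|N|}\sum_{y\in N}\nu(x+y)$; for an ideal $I\subset R$ let $\nu \bmod I$ be the push-forward of $\nu$ to $R^l/IR^l$. Write $\|\mu\|_{L^1}=\sum_x|\mu(x)|$ and $\|\mu\|_2=(\sum_x\mu(x)^2)^{1/2}$, and let $\|\xi \bmod \mathfrak m\|_\infty=\max_{x\in R/\mathfrak m}\mathbb P(\xi\equiv x \bmod \mathfrak m)$.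 Then there is a constant $C$, depending only on $R$, $u$, $\varepsilon$ and the smallest non-zero value of $\mathbb P(\xi=r)$, $r\in R$, such that for all such $l,k$ and every signed measure $\nu$ on $R^l$, $$\sum_{M}\mathbb P(\mathcal M_{l,k}=M)\,\|\mathrm{proj}_{\mathrm{im}\,M}\,\nu\|_{L^1}\;\le\;\sum_{I\subset R} C\,(1+\varepsilon)^l\,\|\nu \bmod I\|_2\;+\;C\,(1+\varepsilon)^l\max\Big(\tfrac{1}{\operatorname{char}(R/\mathfrak m)},\,\|\xi\bmod\mathfrak m\|_\infty\Big)^{l}\,\|\nu\|_{L^1},$$ where the sum runs over all ideals $I$ of $R$, including $0$ and $R$. -/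

import Mathlib

open scoped BigOperators

noncomputable section

namespace ColumnSwap

/-! Signed measures on a finite set `X` are identified with their mass functions `X → ℝ`.
All the sums below range over finite types, so `∑ᶠ` is the ordinary finite sum. -/

/-- The `L¹` norm (total variation) `∑ |ν x|` of a signed measure on a finite set. -/
def l1Norm {X : Type*} (ν : X → ℝ) : ℝ := ∑ᶠ x, |ν x|

/-- The Euclidean norm of a signed measure on a finite set. -/
def l2Norm {X : Type*} (ν : X → ℝ) : ℝ := √(∑ᶠ x, ν x ^ 2)

/-- The push-forward of a signed measure along a map of finite sets. -/
def pushforward {X Y : Type*} (f : X → Y) (ν : X → ℝ) (y : Y) : ℝ :=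
  ∑ᶠ x : {x : X // f x = y}, ν x

section Module

variable {R M : Type*} [CommRing R] [AddCommGroup M] [Module R M]

/-- `proj_N ν`: the average of the signed measure `ν` over the cosets of the submodule `N`. -/
def proj (N : Submodule R M) (ν : M → ℝ) (x : M) : ℝ :=
  (∑ᶠ y : N, ν (x + y)) / (Nat.card N : ℝ)

/-- `ν mod I`: the push-forward of `ν` to `M / I M`. -/
def modIdeal (I : Ideal R) (ν : M → ℝ) : (M ⧸ (I • (⊤ : Submodule R M))) → ℝ :=
  pushforward (Submodule.mkQ (I • (⊤ : Submodule R M))) ν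

end Module

/-- The probability that an `l × k` matrix whose entries are independent with law `ξ`
equals `M`. -/
def iidMatrixProb {R : Type*} (ξ : PMF R) {l k : ℕ} (M : Matrix (Fin l) (Fin k) R) : ℝ :=
  ∏ i, ∏ j, (ξ (M i j)).toReal

/-- The image of `M : R^k → R^l`, i.e. the span of its columns. -/
def matrixImage {R : Type*} [CommRing R] {l k : ℕ} (M : Matrix (Fin l) (Fin k) R) :
    Submodule R (Fin l → R) :=
  LinearMap.range M.mulVecLin

/-- `ξ` is not concentrated on a translate of a proper ideal. -/
def NotOnIdealTranslate {R : Type*} [CommRing R] (ξ : PMF R) : Prop :=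
  ∀ (I : Ideal R) (a : R), I ≠ ⊤ → ¬ ∀ r ∈ ξ.support, ∃ s ∈ I, r = a + s

/-- `ξ` is not concentrated on a translate of a proper subring, even after multiplying `ξ`
by a unit. -/
def NotOnSubringTranslate {R : Type*} [CommRing R] (ξ : PMF R) : Prop :=
  ∀ (S : Subring R) (a : R) (c : Rˣ), S ≠ ⊤ → ¬ ∀ r ∈ ξ.support, ∃ s ∈ S, r = a + c * s

/-- The `l^∞` norm of the law that `ξ` induces on the residue field. -/
def residueLinf {R : Type*} [CommRing R] [IsLocalRing R] (ξ : PMF R) : ℝ :=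
  ⨆ x : IsLocalRing.ResidueField R, (ξ.map (IsLocalRing.residue R) x).toReal

/-- `max (1 / char (R/𝔪), ‖ξ mod 𝔪‖_∞)`. -/
def maxBound {R : Type*} [CommRing R] [IsLocalRing R] (ξ : PMF R) : ℝ :=
  max (1 / (ringChar (IsLocalRing.ResidueField R) : ℝ)) (residueLinf ξ)

end ColumnSwap

end

/-! The Pontryagin dual `A = AddChar R ℂ` is an `R`-module, and `χ ∈ A^l` is trivial on `im M`
exactly when every column satisfies `∑ M i j • χ i = 0`. Columns are independent, so this has
probability `hitProb p χ {0} ^ k`. By Cauchy–Schwarz and Parseval, the `L¹` norm of the projection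
is at most the root of `∑ ‖fourier ν χ‖ ^ 2` over such `χ`. Everything thus rests on bounding
`hitProb p χ {0}`.

Each `χ` gets a robust subgroup `K ≤ A`: it contains most coordinates, and every proper subgroup
misses at least `s` more. Fourier inversion then spreads `∑ x i • χ i` evenly over cosets of
`diffSpan T K`, where `T` is the support of `ξ`, up to an error `ρ ^ s`. The ideal and subring
hypotheses yield `diffSpan_dichotomy`, so that `hitProb_zero_bounds` gives roughly `1 / |K|` always.
It gains a factor `β = maxBound ξ` unless `K` is a submodule containing all coordinates.

In the generic case, Parseval over `K^l` produces `|K|^l` times the squared norm of `ν mod I`, with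
`I` the ideal annihilated by `K`. Otherwise there are only about `|K|^l` vectors `χ` per `K`, and a
union bound with the contraction `‖proj ν‖ ≤ ‖ν‖` gives the `β ^ l` term. -/

noncomputable section

set_option linter.unusedSectionVars false

namespace ColumnSwap

open Finset

/-! ### Character orthogonality on a finite abelian group -/

section Orthogonality

variable {A : Type*} [AddCommGroup A] [Fintype A]

open scoped Classical in
lemma sum_addSubgroup_addChar (H : AddSubgroup A) (ψ : AddChar A ℂ) :
    ∑ h : H, ψ h = if ∀ h ∈ H, ψ h = 1 then (Nat.card H : ℂ) else 0 := by
  have h := AddChar.sum_eq_ite (ψ.compAddMonoidHom H.subtype)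
  simp only [AddChar.compAddMonoidHom_apply, AddSubgroup.coe_subtype] at h
  rw [h, Nat.card_eq_fintype_card]
  refine if_congr ?_ rfl rfl
  rw [AddChar.eq_zero_iff]
  simp

open scoped Classical in
lemma card_mul_sum_annihilator (H : AddSubgroup A) (a : A) :
    (Nat.card H : ℂ) * ∑ ψ : AddChar A ℂ with ∀ h ∈ H, ψ h = 1, ψ a =
      if a ∈ H then (Fintype.card A : ℂ) else 0 := by
  have h1 : ∑ h : H, ∑ ψ : AddChar A ℂ, ψ (a - h) =
      if a ∈ H then (Fintype.card A : ℂ) else 0 := by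
    simp only [AddChar.sum_apply_eq_ite, sub_eq_zero]
    split_ifs with ha
    · rw [Finset.sum_eq_single ⟨a, ha⟩]
      · simp
      · intro b _ hb
        rw [if_neg]
        rintro rfl
        exact hb rfl
      · simp
    · refine Finset.sum_eq_zero fun b _ => if_neg ?_
      rintro rfl
      exact ha b.2
  rw [← h1, Finset.sum_comm, Finset.mul_sum, Finset.sum_filter]
  refine Finset.sum_congr rfl fun ψ _ => ?_
  have h2 : ∀ h : H, ψ (a - h) = ψ a * ψ ((-h : H) : A) := fun h => by
    rw [← AddChar.map_add_eq_mul, sub_eq_add_neg]; rfl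
  simp only [h2]
  have h3 := Equiv.sum_comp (Equiv.neg H) (fun h : H => ψ h)
  simp only [Equiv.neg_apply] at h3
  rw [← Finset.mul_sum, h3, sum_addSubgroup_addChar]
  split_ifs <;> ring

open scoped Classical in
-- Expand both indicators in characters: those trivial on `H` are precisely the ones that cancel.
lemma indicator_zero_sub_indicator (H : AddSubgroup A) (a : A) :
    (if a = 0 then (1 : ℂ) else 0) - (if a ∈ H then 1 else 0) / Nat.card H =
      (∑ ψ : AddChar A ℂ with ¬ ∀ h ∈ H, ψ h = 1, ψ a) / Fintype.card A := by
  have h1 := card_mul_sum_annihilator H a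
  have h2 := AddChar.sum_apply_eq_ite a
  rw [← Finset.sum_filter_add_sum_filter_not univ (fun ψ : AddChar A ℂ => ∀ h ∈ H, ψ h = 1)] at h2
  have hH : (Nat.card H : ℂ) ≠ 0 := Nat.cast_ne_zero.2 Nat.card_pos.ne'
  have hA : (Fintype.card A : ℂ) ≠ 0 := Nat.cast_ne_zero.2 Fintype.card_pos.ne'
  have h3 : ∑ ψ : AddChar A ℂ with ∀ h ∈ H, ψ h = 1, ψ a =
      (if a ∈ H then (Fintype.card A : ℂ) else 0) / Nat.card H := by
    rw [← h1]; field_simp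
  rw [h3, add_comm, ← eq_sub_iff_add_eq] at h2
  rw [h2]
  split_ifs <;> field_simp <;> ring

lemma norm_add_lt_two {z w : ℂ} (hz : ‖z‖ = 1) (hw : ‖w‖ = 1) (h : z ≠ w) : ‖z + w‖ < 2 := by
  have h1 := parallelogram_law_with_norm ℂ z w
  have h2 : 0 < ‖z - w‖ := norm_pos_iff.2 (sub_ne_zero.2 h)
  rw [hz, hw] at h1
  nlinarith [norm_nonneg (z + w)]

variable (A) in
/-- The values of two characters at distinct points, when distinct, are uniformly separated. -/
lemma exists_norm_addChar_add_le :
    ∃ s : ℝ, 0 ≤ s ∧ s < 2 ∧ ∀ (ψ : AddChar A ℂ) (a b : A), ψ a ≠ ψ b → ‖ψ a + ψ b‖ ≤ s := by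
  let T := {t : AddChar A ℂ × A × A // t.1 t.2.1 ≠ t.1 t.2.2}
  rcases isEmpty_or_nonempty T with hT | hT
  · exact ⟨0, le_rfl, two_pos, fun ψ a b h => (hT.false ⟨⟨ψ, a, b⟩, h⟩).elim⟩
  · obtain ⟨t, ht⟩ := Finite.exists_max (fun t : T => ‖t.1.1 t.1.2.1 + t.1.1 t.1.2.2‖)
    exact ⟨_, norm_nonneg _, norm_add_lt_two (AddChar.norm_apply _ _) (AddChar.norm_apply _ _) t.2,
      fun ψ a b h => ht ⟨⟨ψ, a, b⟩, h⟩⟩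

end Orthogonality

/-! ### Fourier bounds for random combinations of the coordinates of `χ` -/

section Hitting

variable {R : Type*} [CommRing R] [Fintype R] {A : Type*} [AddCommGroup A] [Module R A]

open scoped Classical in
/-- The probability that `∑ xᵢ χᵢ` lies in `S`, for independent `xᵢ` with mass function `p`. -/
def hitProb (p : R → ℝ) {l : ℕ} (χ : Fin l → A) (S : Set A) : ℝ :=
  ∑ x : Fin l → R, (∏ i, p (x i)) * if ∑ i, x i • χ i ∈ S then 1 else 0

/-- The Fourier transform of the law of `x • a`, where `x` has mass function `p`. -/
def charSum (p : R → ℝ) (ψ : AddChar A ℂ) (a : A) : ℂ := ∑ r, (p r : ℂ) * ψ (r • a)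

lemma addChar_sum_eq_prod {ι : Type*} (s : Finset ι) (ψ : AddChar A ℂ) (f : ι → A) :
    ψ (∑ i ∈ s, f i) = ∏ i ∈ s, ψ (f i) := by
  classical
  induction s using Finset.induction_on with
  | empty => simp
  | insert a s ha ih => rw [sum_insert ha, prod_insert ha, AddChar.map_add_eq_mul, ih]

lemma prod_charSum (p : R → ℝ) (ψ : AddChar A ℂ) {l : ℕ} (χ : Fin l → A) :
    ∏ i, charSum p ψ (χ i) = ∑ x : Fin l → R, (∏ i, (p (x i) : ℂ)) * ψ (∑ i, x i • χ i) := by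
  unfold charSum
  rw [Finset.prod_univ_sum, Fintype.piFinset_univ]
  simp only [Finset.prod_mul_distrib, addChar_sum_eq_prod]

lemma sum_prod_eq_one {p : R → ℝ} (hp : ∑ r, p r = 1) (l : ℕ) :
    ∑ x : Fin l → R, ∏ i, p (x i) = 1 := by
  have := Finset.prod_univ_sum (fun _ : Fin l => (univ : Finset R)) (fun _ => p)
  rw [Fintype.piFinset_univ] at this
  rw [← this]; simp [hp]

lemma hitProb_nonneg {p : R → ℝ} (hp : ∀ r, 0 ≤ p r) {l : ℕ} (χ : Fin l → A) (S : Set A) :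
    0 ≤ hitProb p χ S :=
  Finset.sum_nonneg fun x _ => mul_nonneg (Finset.prod_nonneg fun i _ => hp _) (by split_ifs <;> simp)

lemma hitProb_le_one {p : R → ℝ} (hp : ∀ r, 0 ≤ p r) (hp1 : ∑ r, p r = 1) {l : ℕ}
    (χ : Fin l → A) (S : Set A) : hitProb p χ S ≤ 1 := by
  rw [← sum_prod_eq_one hp1 l]
  refine Finset.sum_le_sum fun x _ => mul_le_of_le_one_right (Finset.prod_nonneg fun i _ => hp _) ?_
  split_ifs <;> simp

variable [Fintype A]

/-- Take expectations in `indicator_zero_sub_indicator`; at most `|A|` characters contribute, which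
the normalisation absorbs. -/
lemma hitProb_zero_le {p : R → ℝ} {l : ℕ} (χ : Fin l → A) (H : AddSubgroup A) {c : ℝ} (hc : 0 ≤ c)
    (h : ∀ ψ : AddChar A ℂ, (¬ ∀ h ∈ H, ψ h = 1) → ‖∏ i, charSum p ψ (χ i)‖ ≤ c) :
    hitProb p χ {0} ≤ hitProb p χ H / Nat.card H + c := by
  classical
  have key : ((hitProb p χ {0} - hitProb p χ H / Nat.card H : ℝ) : ℂ) =
      (∑ ψ : AddChar A ℂ with ¬ ∀ h ∈ H, ψ h = 1, ∏ i, charSum p ψ (χ i)) / Fintype.card A := by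
    have : ∀ x : Fin l → R, (∏ i, (p (x i) : ℂ)) *
        ((if ∑ i, x i • χ i = 0 then (1 : ℂ) else 0) -
          (if ∑ i, x i • χ i ∈ H then 1 else 0) / Nat.card H) =
        (∏ i, (p (x i) : ℂ)) *
          ((∑ ψ : AddChar A ℂ with ¬ ∀ h ∈ H, ψ h = 1, ψ (∑ i, x i • χ i)) / Fintype.card A) :=
      fun x => by rw [indicator_zero_sub_indicator H]
    have h2 := Finset.sum_congr (rfl : (univ : Finset (Fin l → R)) = univ) fun x _ => this x
    simp only [prod_charSum]
    rw [Finset.sum_comm, Finset.sum_div]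
    simp only [← Finset.mul_sum, mul_div_assoc]
    rw [← h2]
    unfold hitProb
    push_cast
    rw [Finset.sum_div, ← Finset.sum_sub_distrib]
    refine Finset.sum_congr rfl fun x _ => ?_
    simp only [Set.mem_singleton_iff, SetLike.mem_coe]
    rw [mul_sub, mul_div_assoc]
    split_ifs <;> simp
  have hA : (0 : ℝ) < Fintype.card A := Nat.cast_pos.2 Fintype.card_pos
  have h3 : ‖((hitProb p χ {0} - hitProb p χ H / Nat.card H : ℝ) : ℂ)‖ ≤ c := by
    rw [key, norm_div, Complex.norm_natCast, div_le_iff₀ hA]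
    refine (norm_sum_le _ _).trans ((Finset.sum_le_sum fun ψ hψ => h ψ (mem_filter.1 hψ).2).trans ?_)
    rw [Finset.sum_const, nsmul_eq_mul, mul_comm]
    refine mul_le_mul_of_nonneg_left ?_ hc
    rw [← AddChar.card_eq (α := A)]
    exact_mod_cast Finset.card_le_univ _
  rw [Complex.norm_real] at h3
  linarith [le_abs_self (hitProb p χ {0} - hitProb p χ H / Nat.card H), Real.norm_eq_abs
    (hitProb p χ {0} - hitProb p χ H / Nat.card H)]

lemma norm_charSum_le_one {p : R → ℝ} (hp : ∀ r, 0 ≤ p r) (hp1 : ∑ r, p r = 1)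
    (ψ : AddChar A ℂ) (a : A) : ‖charSum p ψ a‖ ≤ 1 := by
  rw [← hp1]
  refine norm_sum_le_of_le _ fun r _ => ?_
  rw [norm_mul, AddChar.norm_apply, mul_one, Complex.norm_real, Real.norm_of_nonneg (hp r)]

lemma norm_charSum_le {p : R → ℝ} (hp : ∀ r, 0 ≤ p r) (hp1 : ∑ r, p r = 1) {α s : ℝ}
    (hs : ∀ (ψ : AddChar A ℂ) (a b : A), ψ a ≠ ψ b → ‖ψ a + ψ b‖ ≤ s)
    (hα : 0 ≤ α) (ψ : AddChar A ℂ) (a : A) {r₁ r₂ : R} (h₁ : α ≤ p r₁) (h₂ : α ≤ p r₂)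
    (h : ψ (r₁ • a) ≠ ψ (r₂ • a)) : ‖charSum p ψ a‖ ≤ 1 - α * (2 - s) := by
  classical
  have hne : r₁ ≠ r₂ := by rintro rfl; exact h rfl
  -- Split off mass `α` at each of the two atoms. Only this pair cancels: it contributes at most `α
  -- * s` instead of `2 * α`.
  let q : R → ℝ := fun r => p r - (if r = r₁ then α else 0) - (if r = r₂ then α else 0)
  have hq : ∀ r, 0 ≤ q r := by
    intro r
    simp only [q]
    by_cases e1 : r = r₁
    · subst e1; simp [hne, h₁]
    · by_cases e2 : r = r₂
      · subst e2; simp [e1, h₂]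
      · simp [e1, e2, hp]
  have hq1 : ∑ r, q r = 1 - 2 * α := by
    simp only [q, Finset.sum_sub_distrib, hp1, Finset.sum_ite_eq', mem_univ, if_true]; ring
  have e : charSum p ψ a = ∑ r, (q r : ℂ) * ψ (r • a) + α * (ψ (r₁ • a) + ψ (r₂ • a)) := by
    unfold charSum
    simp only [q, Complex.ofReal_sub, sub_mul, Finset.sum_sub_distrib]
    have : ∀ t : R, ∑ r, (((if r = t then α else 0 : ℝ)) : ℂ) * ψ (r • a) = α * ψ (t • a) := by
      intro t
      rw [Finset.sum_eq_single t]
      · simp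
      · intro b _ hb; simp [hb]
      · simp
    rw [this, this]; ring
  rw [e]
  have n1 : ‖∑ r, (q r : ℂ) * ψ (r • a)‖ ≤ 1 - 2 * α := by
    rw [← hq1]
    refine norm_sum_le_of_le _ fun r _ => ?_
    rw [norm_mul, AddChar.norm_apply, mul_one, Complex.norm_real, Real.norm_of_nonneg (hq r)]
  have n2 : ‖(α : ℂ) * (ψ (r₁ • a) + ψ (r₂ • a))‖ ≤ α * s := by
    rw [norm_mul, Complex.norm_real, Real.norm_of_nonneg hα]
    exact mul_le_mul_of_nonneg_left (hs _ _ _ h) hα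
  calc _ ≤ _ := norm_add_le _ _
    _ ≤ _ := by linarith

end Hitting

/-! ### Robust subgroups and how many vectors share one -/

section Robust

variable {A : Type*} [AddCommGroup A] [Fintype A]

open scoped Classical in
/-- The number of coordinates of `χ` outside `K`. -/
def offCount (K : AddSubgroup A) {l : ℕ} (χ : Fin l → A) : ℕ := #{i | χ i ∉ K}

/-- `K` contains most coordinates of `χ`, and no proper subgroup of `K` does. -/
def IsRobust (s : ℕ) (K : AddSubgroup A) {l : ℕ} (χ : Fin l → A) : Prop :=
  offCount K χ ≤ s * Fintype.card A ∧ ∀ K' < K, s + offCount K χ ≤ offCount K' χ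

lemma exists_isRobust (s : ℕ) {l : ℕ} (χ : Fin l → A) : ∃ K : AddSubgroup A, IsRobust s K χ := by
  -- Minimising this penalised count gives both clauses: compare with `⊤` for the first, with `K' <
  -- K` (smaller by at least one element) for the second.
  obtain ⟨K, hK⟩ := Finite.exists_min
    (fun K : AddSubgroup A => offCount K χ + s * Nat.card K)
  refine ⟨K, ?_, fun K' hK' => ?_⟩
  · have h := hK ⊤
    have h0 : offCount (⊤ : AddSubgroup A) χ = 0 := by simp [offCount]
    have h1 : Nat.card (⊤ : AddSubgroup A) = Fintype.card A := by
      rw [AddSubgroup.card_top, Nat.card_eq_fintype_card]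
    rw [h0, h1] at h
    omega
  · have h := hK K'
    have h1 : Nat.card K' < Nat.card K := Set.Finite.card_lt_card (Set.toFinite _) hK'
    have h2 : s * (Nat.card K' + 1) ≤ s * Nat.card K := Nat.mul_le_mul_left _ h1
    rw [mul_add, mul_one] at h2
    omega

open scoped Classical in
lemma offCount_eq_add {K' K : AddSubgroup A} (h : K' ≤ K) {l : ℕ} (χ : Fin l → A) :
    offCount K' χ = #{i | χ i ∈ K ∧ χ i ∉ K'} + offCount K χ := by
  unfold offCount
  rw [← Finset.card_union_of_disjoint]
  · congr 1
    ext i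
    simp only [mem_filter, mem_univ, true_and, mem_union]
    have := @h (χ i)
    tauto
  · rw [Finset.disjoint_left]
    intro i
    simp only [mem_filter, mem_univ, true_and]
    tauto

open scoped Classical in
-- Chernoff argument: the generating function `∑ z ^ offCount K χ` factors over coordinates.
lemma card_offCount_le_mul_pow (K : AddSubgroup A) (l m : ℕ) {z : ℝ} (hz : 0 ≤ z) (hz1 : z ≤ 1) :
    (#{χ : Fin l → A | offCount K χ ≤ m} : ℝ) * z ^ m ≤
      (Nat.card K + z * Fintype.card A) ^ l := by
  let f : A → ℝ := fun a => if a ∈ K then 1 else z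
  have hf : ∀ a, 0 ≤ f a := fun a => by simp only [f]; split_ifs <;> linarith
  have h1 : ∑ χ : Fin l → A, z ^ offCount K χ = (∑ a, f a) ^ l := by
    rw [Fintype.sum_pow]
    refine Finset.sum_congr rfl fun χ _ => ?_
    simp only [f]
    rw [Finset.prod_ite, Finset.prod_const_one, one_mul, Finset.prod_const]
    rfl
  have h2 : ∑ a, f a ≤ Nat.card K + z * Fintype.card A := by
    simp only [f]
    rw [Finset.sum_ite, Finset.sum_const, Finset.sum_const, nsmul_eq_mul, nsmul_eq_mul, mul_one]
    refine add_le_add (le_of_eq ?_) ?_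
    · rw [Nat.card_eq_fintype_card, Fintype.card_subtype]
    · rw [mul_comm]
      exact mul_le_mul_of_nonneg_left (by exact_mod_cast Finset.card_le_univ _) hz
  calc _ = ∑ χ : Fin l → A with offCount K χ ≤ m, z ^ m := by
        rw [Finset.sum_const, nsmul_eq_mul]
    _ ≤ ∑ χ : Fin l → A with offCount K χ ≤ m, z ^ offCount K χ :=
        Finset.sum_le_sum fun χ hχ => pow_le_pow_of_le_one hz hz1 (mem_filter.1 hχ).2
    _ ≤ ∑ χ : Fin l → A, z ^ offCount K χ :=
        Finset.sum_le_sum_of_subset_of_nonneg (filter_subset _ _) fun _ _ _ => pow_nonneg hz _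
    _ = _ := h1
    _ ≤ _ := pow_le_pow_left₀ (Finset.sum_nonneg fun a _ => hf a) h2 _

end Robust

/-! ### Where the ideal and subring hypotheses enter -/

section DiffSpan

variable {R : Type*} [CommRing R] {A : Type*} [AddCommGroup A] [Module R A]

/-- The additive subgroup generated by the products of differences of elements of `T` with
elements of `K`. -/
def diffSpan (T : Set R) (K : AddSubgroup A) : AddSubgroup A :=
  AddSubgroup.closure {x | ∃ r ∈ T, ∃ r' ∈ T, ∃ κ ∈ K, x = (r - r') • κ}

lemma sub_smul_mem_diffSpan {T : Set R} {K : AddSubgroup A} {r r' : R} (hr : r ∈ T) (hr' : r' ∈ T)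
    {κ : A} (hκ : κ ∈ K) : (r - r') • κ ∈ diffSpan T K :=
  AddSubgroup.subset_closure ⟨r, hr, r', hr', κ, hκ, rfl⟩

/-- Otherwise all differences are non-units and `T` lies in a translate of the maximal ideal. -/
lemma exists_isUnit_sub [IsLocalRing R] {T : Set R}
    (hT : ∀ (I : Ideal R) (a : R), I ≠ ⊤ → ¬ ∀ r ∈ T, ∃ s ∈ I, r = a + s) :
    ∃ r ∈ T, ∃ r' ∈ T, IsUnit (r - r') := by
  have hne : ∃ r, r ∈ T := by
    by_contra! h
    exact hT ⊥ 0 bot_ne_top fun r hr => (h r hr).elim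
  obtain ⟨r₀, h₀⟩ := hne
  by_contra! h
  refine hT (IsLocalRing.maximalIdeal R) r₀ (IsLocalRing.maximalIdeal.isMaximal R).ne_top
    fun r hr => ⟨r - r₀, ?_, by ring⟩
  rw [IsLocalRing.mem_maximalIdeal]
  exact h r hr r₀ h₀

/-- A nonzero element of `H / K` has `q`-power order, so `q` divides the index. -/
lemma mul_card_le_card_of_lt [Finite A] {q n : ℕ} (hq : q.Prime) (hA : ∀ a : A, q ^ n • a = 0)
    {K H : AddSubgroup A} (h : K < H) : q * Nat.card K ≤ Nat.card H := by
  obtain ⟨x, hxH, hxK⟩ := SetLike.exists_of_lt h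
  have h1 : K.relIndex H * Nat.card K = Nat.card H := by
    have := AddSubgroup.relIndex_mul_relIndex ⊥ K H bot_le h.le
    rwa [AddSubgroup.relIndex_bot_left, AddSubgroup.relIndex_bot_left, mul_comm] at this
  let y : H ⧸ K.addSubgroupOf H := QuotientAddGroup.mk (⟨x, hxH⟩ : H)
  have hy : y ≠ 0 := by
    intro hy
    rw [QuotientAddGroup.eq_zero_iff] at hy
    exact hxK hy
  have hy2 : addOrderOf y ∣ q ^ n := by
    rw [addOrderOf_dvd_iff_nsmul_eq_zero]
    change ((q ^ n • (⟨x, hxH⟩ : H) : H) : H ⧸ K.addSubgroupOf H) = 0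
    have : q ^ n • (⟨x, hxH⟩ : H) = 0 := Subtype.ext (hA x)
    rw [this]; rfl
  have hdvd : q ∣ K.relIndex H := by
    have h3 : addOrderOf y ≠ 1 := fun h => hy (AddMonoid.addOrderOf_eq_one_iff.1 h)
    obtain ⟨m, -, hm⟩ := (Nat.dvd_prime_pow hq).1 hy2
    have hm0 : m ≠ 0 := by rintro rfl; exact h3 (by simpa using hm)
    refine ((dvd_pow_self q hm0).trans hm.symm.dvd).trans ?_
    exact addOrderOf_dvd_natCard y
  rw [← h1]
  refine Nat.mul_le_mul_right _ (Nat.le_of_dvd (Nat.pos_of_ne_zero ?_) hdvd)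
  intro h0
  rw [h0, zero_mul] at h1
  exact Nat.card_pos.ne h1

/-- Either `K` is a submodule contained in `diffSpan T K`, or `diffSpan T K` is larger than `K`
by a factor of at least `q`. -/
lemma diffSpan_dichotomy [IsLocalRing R] [Finite A] {T : Set R}
    (hT : ∀ (I : Ideal R) (a : R), I ≠ ⊤ → ¬ ∀ r ∈ T, ∃ s ∈ I, r = a + s)
    (hT' : ∀ (S : Subring R) (a : R) (c : Rˣ), S ≠ ⊤ → ¬ ∀ r ∈ T, ∃ s ∈ S, r = a + c * s)
    {q n : ℕ} (hq : q.Prime) (hA : ∀ a : A, q ^ n • a = 0) (K : AddSubgroup A) :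
    ((∀ r : R, ∀ κ ∈ K, r • κ ∈ K) ∧ K ≤ diffSpan T K) ∨
      q * Nat.card K ≤ Nat.card (diffSpan T K) := by
  obtain ⟨r₁, hr₁, r₂, hr₂, c, hc⟩ := exists_isUnit_sub hT
  let cK : AddSubgroup A := K.map (DistribSMul.toAddMonoidHom A (c : R))
  have hcK : Nat.card cK = Nat.card K :=
    Nat.card_image_of_injective (f := fun a : A => (c : R) • a)
      (fun a b h => by
        have := congrArg (fun x => ((c⁻¹ : Rˣ) : R) • x) h
        simpa [smul_smul] using this) _
  have hle : cK ≤ diffSpan T K := by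
    rintro _ ⟨κ, hκ, rfl⟩
    change (c : R) • κ ∈ _
    rw [hc]
    exact sub_smul_mem_diffSpan hr₁ hr₂ hκ
  -- `diffSpan T K` contains the copy `c K` of `K`. Strict inclusion gains a factor `q`. Under
  -- equality each `c⁻¹ (r - r₁)` maps `K` into itself, so `T` lies in `r₁ + c S` for the ring `S`
  -- of multipliers of `K`, which forces `S = R`.
  rcases hle.lt_or_eq with hlt | heq
  · right
    rw [← hcK]
    exact mul_card_le_card_of_lt hq hA hlt
  · left
    let S : Subring R :=
      { carrier := {r | ∀ κ ∈ K, r • κ ∈ K}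
        mul_mem' := fun {a b} ha hb κ hκ => by rw [mul_smul]; exact ha _ (hb _ hκ)
        one_mem' := fun κ hκ => by rwa [one_smul]
        add_mem' := fun {a b} ha hb κ hκ => by rw [add_smul]; exact add_mem (ha _ hκ) (hb _ hκ)
        zero_mem' := fun κ _ => by rw [zero_smul]; exact zero_mem _
        neg_mem' := fun {a} ha κ hκ => by rw [neg_smul]; exact neg_mem (ha _ hκ) }
    have hS : S = ⊤ := by
      by_contra hS
      refine hT' S r₁ c hS fun r hr => ⟨((c⁻¹ : Rˣ) : R) * (r - r₁), fun κ hκ => ?_, by simp⟩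
      have h1 : (r - r₁) • κ ∈ cK := heq ▸ sub_smul_mem_diffSpan hr hr₁ hκ
      obtain ⟨κ', hκ', h2⟩ := h1
      rw [mul_smul, ← h2]
      change ((c⁻¹ : Rˣ) : R) • (c : R) • κ' ∈ K
      simpa [smul_smul] using hκ'
    have hstab : ∀ r : R, ∀ κ ∈ K, r • κ ∈ K := fun r => by
      have : r ∈ S := hS ▸ Subring.mem_top r
      exact this
    refine ⟨hstab, fun κ hκ => heq ▸ ?_⟩
    refine ⟨((c⁻¹ : Rˣ) : R) • κ, hstab _ _ hκ, ?_⟩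
    change (c : R) • ((c⁻¹ : Rˣ) : R) • κ = κ
    simp [smul_smul]

end DiffSpan

/-! ### Anticoncentration from robustness -/

section Anticoncentration

variable {R : Type*} [CommRing R] [Fintype R] {A : Type*} [AddCommGroup A] [Module R A] [Fintype A]

lemma hitProb_zero_le_of_isRobust {p : R → ℝ} (hp : ∀ r, 0 ≤ p r) (hp1 : ∑ r, p r = 1) {α δ ρ : ℝ}
    (hδ : ∀ (ψ : AddChar A ℂ) (a b : A), ψ a ≠ ψ b → ‖ψ a + ψ b‖ ≤ δ)
    (hα : 0 ≤ α) (hαp : ∀ r, p r ≠ 0 → α ≤ p r) (hρ0 : 0 ≤ ρ) (hρ1 : ρ ≤ 1)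
    (hρ : 1 - α * (2 - δ) ≤ ρ) {l : ℕ} {χ : Fin l → A} {s : ℕ} {K : AddSubgroup A}
    (hK : IsRobust s K χ) {H : AddSubgroup A} (hH : H ≤ diffSpan {r | p r ≠ 0} K) :
    hitProb p χ {0} ≤ hitProb p χ H / Nat.card H + ρ ^ s := by
  classical
  refine hitProb_zero_le χ H (pow_nonneg hρ0 s) fun ψ hψ => ?_
  -- `K'` collects the coordinate values at which `ψ` does not distinguish atoms of `p`. It is
  -- proper in `K`, since otherwise `ψ` would be trivial on `diffSpan` and hence on `H`. Robustness
  -- then supplies `s` coordinates in `K` outside `K'`, each costing a factor `ρ`.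
  let K' : AddSubgroup A :=
    { carrier := {κ | κ ∈ K ∧ ∀ r r', p r ≠ 0 → p r' ≠ 0 → ψ ((r - r') • κ) = 1}
      zero_mem' := ⟨zero_mem _, fun r r' _ _ => by simp⟩
      add_mem' := fun {a b} ha hb => ⟨add_mem ha.1 hb.1, fun r r' hr hr' => by
        rw [smul_add, AddChar.map_add_eq_mul, ha.2 r r' hr hr', hb.2 r r' hr hr', one_mul]⟩
      neg_mem' := fun {a} ha => ⟨neg_mem ha.1, fun r r' hr hr' => by
        rw [smul_neg, AddChar.map_neg_eq_inv, ha.2 r r' hr hr', inv_one]⟩ }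
  have hle : K' ≤ K := fun κ hκ => hκ.1
  have hlt : K' < K := by
    refine lt_of_le_of_ne hle fun heq => hψ fun h hh => ?_
    have h1 : diffSpan {r | p r ≠ 0} K ≤ ψ.toMonoidHom.ker.toAddSubgroup' := by
      refine (AddSubgroup.closure_le _).2 ?_
      rintro _ ⟨r, hr, r', hr', κ, hκ, rfl⟩
      have : κ ∈ K' := heq ▸ hκ
      exact this.2 r r' hr hr'
    exact h1 (hH hh)
  have hs : s ≤ #{i | χ i ∈ K ∧ χ i ∉ K'} := by
    have := hK.2 K' hlt
    rw [offCount_eq_add hle] at this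
    omega
  rw [norm_prod]
  calc ∏ i, ‖charSum p ψ (χ i)‖ ≤ ∏ i, if χ i ∈ K ∧ χ i ∉ K' then ρ else 1 := by
        refine Finset.prod_le_prod (fun _ _ => norm_nonneg _) fun i _ => ?_
        split_ifs with hi
        · have h1 : ∃ r r', p r ≠ 0 ∧ p r' ≠ 0 ∧ ψ ((r - r') • χ i) ≠ 1 := by
            by_contra! hcon
            exact hi.2 ⟨hi.1, hcon⟩
          obtain ⟨r, r', hr, hr', hne⟩ := h1
          refine (norm_charSum_le hp hp1 hδ hα ψ (χ i) (hαp r hr) (hαp r' hr') fun he => hne ?_).trans hρ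
          rw [sub_smul, AddChar.map_sub_eq_div, he, div_self]
          exact (AddChar.val_isUnit ψ _).ne_zero
        · exact norm_charSum_le_one hp hp1 ψ _
    _ = ρ ^ #{i | χ i ∈ K ∧ χ i ∉ K'} := by
        rw [Finset.prod_ite, Finset.prod_const_one, mul_one, Finset.prod_const]
    _ ≤ ρ ^ s := pow_le_pow_of_le_one hρ0 hρ1 hs

open scoped Classical in
-- Fix all coefficients but the `i`-th. Two admissible values of that one cannot differ by a unit,
-- as this would put `χ i` in `K`; so they share a residue class.
lemma hitProb_le_of_notMem [IsLocalRing R] {p : R → ℝ} (hp : ∀ r, 0 ≤ p r) (hp1 : ∑ r, p r = 1)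
    {β : ℝ} (hβ : ∀ x, ∑ r with IsLocalRing.residue R r = x, p r ≤ β) {l : ℕ} {χ : Fin l → A}
    {K : AddSubgroup A} (hK : ∀ r : R, ∀ κ ∈ K, r • κ ∈ K) {i : Fin l} (hi : χ i ∉ K) :
    hitProb p χ K ≤ β := by
  obtain ⟨l, rfl⟩ : ∃ m, l = m + 1 := ⟨l - 1, by have := i.2; omega⟩
  unfold hitProb
  rw [← (Fin.insertNthEquiv (fun _ => R) i).sum_comp, Fintype.sum_prod_type_right]
  have hβ0 : 0 ≤ β := (Finset.sum_nonneg fun r _ => hp r).trans (hβ 0)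
  have key : ∀ y : Fin l → R, ∑ r : R,
      (p r * if r • χ i + ∑ j, y j • χ (i.succAbove j) ∈ K then (1 : ℝ) else 0) ≤ β := by
    intro y
    by_cases h : ∃ r₁ : R, r₁ • χ i + ∑ j, y j • χ (i.succAbove j) ∈ K
    · obtain ⟨r₁, h₁⟩ := h
      refine le_trans ?_ (hβ (IsLocalRing.residue R r₁))
      rw [Finset.sum_filter]
      refine Finset.sum_le_sum fun r _ => ?_
      by_cases h2 : r • χ i + ∑ j, y j • χ (i.succAbove j) ∈ K
      · have h3 : (r - r₁) • χ i ∈ K := by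
          have := sub_mem h2 h₁
          rwa [add_sub_add_right_eq_sub, ← sub_smul] at this
        have h4 : IsLocalRing.residue R r = IsLocalRing.residue R r₁ := by
          rw [← sub_eq_zero, ← map_sub, IsLocalRing.residue_eq_zero_iff,
            IsLocalRing.mem_maximalIdeal]
          rintro ⟨c, hc⟩
          refine hi ?_
          have := hK ((c⁻¹ : Rˣ) : R) _ h3
          rw [← hc] at this
          simpa [smul_smul] using this
        simp [h2, h4]
      · rw [if_neg h2, mul_zero]
        split_ifs
        exacts [hp r, le_rfl]
    · push Not at h
      simp [h, hβ0]
  calc _ = ∑ y : Fin l → R, (∏ j, p (y j)) * ∑ r : R,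
        (p r * if r • χ i + ∑ j, y j • χ (i.succAbove j) ∈ K then (1 : ℝ) else 0) := by
        refine Finset.sum_congr rfl fun y _ => ?_
        rw [Finset.mul_sum]
        refine Finset.sum_congr rfl fun r _ => ?_
        simp only [Fin.insertNthEquiv_apply, Fin.prod_univ_succAbove _ i,
          Fin.sum_univ_succAbove _ i, Fin.insertNth_apply_same, Fin.insertNth_apply_succAbove,
          SetLike.mem_coe]
        ring
    _ ≤ ∑ y : Fin l → R, (∏ j, p (y j)) * β :=
        Finset.sum_le_sum fun y _ => mul_le_mul_of_nonneg_left (key y)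
          (Finset.prod_nonneg fun j _ => hp _)
    _ = β := by rw [← Finset.sum_mul, sum_prod_eq_one hp1, one_mul]

end Anticoncentration

/-! ### Norms and push-forwards as finite sums -/

section Norms

variable {X : Type*} [Fintype X]

lemma l1Norm_eq_sum (ν : X → ℝ) : l1Norm ν = ∑ x, |ν x| := finsum_eq_sum_of_fintype _

lemma l1Norm_nonneg (ν : X → ℝ) : 0 ≤ l1Norm ν := by
  rw [l1Norm_eq_sum]; exact Finset.sum_nonneg fun _ _ => abs_nonneg _

open scoped Classical in
lemma pushforward_eq_sum {Y : Type*} (f : X → Y) (ν : X → ℝ) (y : Y) :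
    pushforward f ν y = ∑ x, if f x = y then ν x else 0 := by
  unfold pushforward
  rw [finsum_eq_sum_of_fintype, ← Finset.sum_filter]
  exact (Finset.sum_subtype _ (fun x => by simp) ν).symm

open scoped Classical in
lemma l2Norm_pushforward_sq {Y : Type*} [Finite Y] (f : X → Y) (ν : X → ℝ) :
    l2Norm (pushforward f ν) ^ 2 = ∑ x, ∑ x', ν x * ν x' * if f x = f x' then 1 else 0 := by
  have := Fintype.ofFinite Y
  unfold l2Norm
  rw [finsum_eq_sum_of_fintype, Real.sq_sqrt (Finset.sum_nonneg fun _ _ => sq_nonneg _)]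
  simp only [pushforward_eq_sum, sq, Finset.sum_mul_sum]
  rw [Finset.sum_comm]
  refine Finset.sum_congr rfl fun x _ => ?_
  rw [Finset.sum_comm]
  refine Finset.sum_congr rfl fun x' _ => ?_
  rw [Finset.sum_eq_single (f x)]
  · by_cases h : f x = f x'
    · simp [h]
    · simp [h, Ne.symm h]
  · intro y _ hy
    simp [hy.symm]
  · simp

end Norms

/-! ### The dual module and Fourier analysis on `R^l` -/

section Dual

variable {R : Type*} [CommRing R]

/-- The Pontryagin dual of `R`, as an `R`-module. -/
instance addCharModule : Module R (AddChar R ℂ) where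
  smul r ψ := ψ.mulShift r
  one_smul ψ := AddChar.mulShift_one ψ
  mul_smul r s ψ := AddChar.ext _ _ fun x =>
    show ψ (r * s * x) = ψ (s * (r * x)) by ring_nf
  smul_zero r := AddChar.ext _ _ fun x => rfl
  smul_add r ψ φ := AddChar.ext _ _ fun x => rfl
  add_smul r s ψ := AddChar.ext _ _ fun x =>
    show ψ ((r + s) * x) = ψ (r * x) * ψ (s * x) by rw [add_mul, AddChar.map_add_eq_mul]
  zero_smul ψ := AddChar.ext _ _ fun x =>
    show ψ (0 * x) = 1 by rw [zero_mul, AddChar.map_zero_eq_one]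

/-- The character `x ↦ ∏ χᵢ(xᵢ)` of `R^l`. -/
def dualChar {l : ℕ} (χ : Fin l → AddChar R ℂ) : AddChar (Fin l → R) ℂ where
  toFun x := ∏ i, χ i (x i)
  map_zero_eq_one' := by simp
  map_add_eq_mul' x y := by simp [AddChar.map_add_eq_mul, Finset.prod_mul_distrib]

lemma dualChar_apply {l : ℕ} (χ : Fin l → AddChar R ℂ) (x : Fin l → R) :
    dualChar χ x = ∏ i, χ i (x i) := rfl

/-- The ideal annihilated by a submodule of the dual. -/
def annIdeal (K : AddSubgroup (AddChar R ℂ)) (hK : ∀ r : R, ∀ ψ ∈ K, r • ψ ∈ K) : Ideal R where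
  carrier := {x | ∀ ψ ∈ K, ψ x = 1}
  zero_mem' := fun ψ _ => ψ.map_zero_eq_one
  add_mem' := fun {a b} ha hb ψ hψ => by
    rw [AddChar.map_add_eq_mul, ha ψ hψ, hb ψ hψ, one_mul]
  smul_mem' := fun r x hx ψ hψ => hx _ (hK r ψ hψ)

lemma mem_smul_top_pi {l : ℕ} (I : Ideal R) (x : Fin l → R) :
    x ∈ I • (⊤ : Submodule R (Fin l → R)) ↔ ∀ i, x i ∈ I := by
  constructor
  · intro hx i
    refine Submodule.smul_induction_on hx (fun r hr n _ => ?_) fun a b ha hb => add_mem ha hb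
    exact I.mul_mem_right _ hr
  · intro hx
    rw [← Finset.univ_sum_single x]
    refine sum_mem fun i _ => ?_
    have : Pi.single i (x i) = x i • (Pi.single i 1 : Fin l → R) := by
      rw [← Pi.single_smul, smul_eq_mul, mul_one]
    rw [this]
    exact Submodule.smul_mem_smul (hx i) trivial

lemma dualChar_matrixImage_iff {l k : ℕ} (χ : Fin l → AddChar R ℂ)
    (M : Matrix (Fin l) (Fin k) R) :
    (∀ y ∈ matrixImage M, dualChar χ y = 1) ↔ ∀ j, ∑ i, M i j • χ i = 0 := by
  have key : ∀ v : Fin k → R, dualChar χ (M.mulVec v) = ∏ j, (∑ i, M i j • χ i) (v j) := by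
    intro v
    simp only [dualChar_apply, Matrix.mulVec, dotProduct, addChar_sum_eq_prod, AddChar.sum_apply]
    rw [Finset.prod_comm]
    rfl
  constructor
  · intro h j
    rw [AddChar.eq_zero_iff]
    intro x
    have := h (M.mulVec (Pi.single j x)) ⟨_, rfl⟩
    rw [key, Finset.prod_eq_single j] at this
    · simpa using this
    · intro j' _ hj'
      simp [Pi.single_eq_of_ne hj']
    · simp
  · rintro h _ ⟨v, rfl⟩
    rw [Matrix.mulVecLin_apply, key]
    simp [h]

variable [Fintype R]

/-- The Fourier transform of a signed measure on `R^l`. -/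
def fourier {l : ℕ} (ν : (Fin l → R) → ℝ) (χ : Fin l → AddChar R ℂ) : ℂ :=
  ∑ x, (ν x : ℂ) * dualChar χ x

open scoped Classical in
lemma sum_dualChar {l : ℕ} (K : AddSubgroup (AddChar R ℂ)) (x : Fin l → R) :
    ∑ χ : Fin l → AddChar R ℂ with ∀ i, χ i ∈ K, dualChar χ x =
      if ∀ i, ∀ ψ ∈ K, ψ (x i) = 1 then (Nat.card K : ℂ) ^ l else 0 := by
  have h0 : ∀ y : R, ∑ ψ : AddChar R ℂ with ψ ∈ K, ψ y =
      if ∀ ψ ∈ K, ψ y = 1 then (Nat.card K : ℂ) else 0 := by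
    intro y
    have h := sum_addSubgroup_addChar K (AddChar.doubleDualEmb y)
    simp only [AddChar.doubleDualEmb_apply] at h
    convert h using 1
    · exact Finset.sum_subtype _ (fun ψ => by simp) fun ψ : AddChar R ℂ => ψ y
    · exact if_congr Iff.rfl rfl rfl
  have h1 : (univ.filter fun χ : Fin l → AddChar R ℂ => ∀ i, χ i ∈ K) =
      Fintype.piFinset fun _ => univ.filter fun ψ => ψ ∈ K := by
    ext χ; simp
  simp only [dualChar_apply]
  rw [h1, ← Finset.prod_univ_sum (fun _ => univ.filter fun ψ => ψ ∈ K)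
    (fun i (ψ : AddChar R ℂ) => ψ (x i))]
  simp only [h0]
  split_ifs with h
  · rw [Finset.prod_congr rfl fun i _ => if_pos (h i)]
    simp
  · push Not at h
    obtain ⟨i, ψ, hψ, hne⟩ := h
    exact Finset.prod_eq_zero (mem_univ i) (if_neg fun h => hne (h ψ hψ))

open scoped Classical in
lemma sum_norm_fourier_sq {l : ℕ} (K : AddSubgroup (AddChar R ℂ)) (ν : (Fin l → R) → ℝ) :
    ∑ χ : Fin l → AddChar R ℂ with ∀ i, χ i ∈ K, ‖fourier ν χ‖ ^ 2 =
      (Nat.card K : ℝ) ^ l * ∑ x, ∑ y, ν x * ν y *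
        if ∀ i, ∀ ψ ∈ K, ψ (x i - y i) = 1 then 1 else 0 := by
  have h1 : ∀ χ : Fin l → AddChar R ℂ, ((‖fourier ν χ‖ ^ 2 : ℝ) : ℂ) =
      ∑ x, ∑ y, (ν x : ℂ) * ν y * dualChar χ (x - y) := by
    intro χ
    rw [Complex.ofReal_pow, ← Complex.mul_conj', fourier, map_sum, Finset.sum_mul_sum]
    refine Finset.sum_congr rfl fun x _ => Finset.sum_congr rfl fun y _ => ?_
    rw [map_mul, Complex.conj_ofReal, ← AddChar.map_neg_eq_conj, sub_eq_add_neg,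
      AddChar.map_add_eq_mul]
    ring
  apply Complex.ofReal_injective
  rw [Complex.ofReal_sum]
  simp only [h1]
  rw [Finset.sum_comm]
  push_cast
  rw [Finset.mul_sum]
  refine Finset.sum_congr rfl fun x _ => ?_
  rw [Finset.sum_comm, Finset.mul_sum]
  refine Finset.sum_congr rfl fun y _ => ?_
  rw [← Finset.mul_sum, sum_dualChar]
  simp only [Pi.sub_apply]
  split_ifs
  · simp; ring
  · simp

open scoped Classical in
-- Characters in `K^l` see only `ν mod I` for `I = annIdeal K hK`; this is the source of the ideal
-- terms in the theorem.
lemma sum_norm_fourier_sq_eq_l2Norm {l : ℕ} (K : AddSubgroup (AddChar R ℂ))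
    (hK : ∀ r : R, ∀ ψ ∈ K, r • ψ ∈ K) (ν : (Fin l → R) → ℝ) :
    ∑ χ : Fin l → AddChar R ℂ with ∀ i, χ i ∈ K, ‖fourier ν χ‖ ^ 2 =
      (Nat.card K : ℝ) ^ l * l2Norm (modIdeal (annIdeal K hK) ν) ^ 2 := by
  rw [sum_norm_fourier_sq, modIdeal, l2Norm_pushforward_sq]
  congr 1
  refine Finset.sum_congr rfl fun x _ => Finset.sum_congr rfl fun y _ => ?_
  congr 1
  refine if_congr ?_ rfl rfl
  rw [Submodule.mkQ_apply, Submodule.mkQ_apply, Submodule.Quotient.eq, mem_smul_top_pi]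
  rfl

open scoped Classical in
lemma sum_norm_fourier_sq_univ {l : ℕ} (ν : (Fin l → R) → ℝ) :
    ∑ χ : Fin l → AddChar R ℂ, ‖fourier ν χ‖ ^ 2 =
      (Fintype.card (Fin l → R) : ℝ) * ∑ x, ν x ^ 2 := by
  have h := sum_norm_fourier_sq (⊤ : AddSubgroup (AddChar R ℂ)) ν
  have h1 : ∀ x y : Fin l → R, (∀ i, ∀ ψ ∈ (⊤ : AddSubgroup (AddChar R ℂ)), ψ (x i - y i) = 1) ↔
      y = x := by
    intro x y
    constructor
    · intro h
      funext i
      have := AddChar.forall_apply_eq_zero.1 fun ψ => h i ψ trivial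
      exact (sub_eq_zero.1 this).symm
    · rintro rfl
      simp
  simp only [AddSubgroup.mem_top, implies_true, Finset.filter_true] at h
  simp only [AddSubgroup.mem_top] at h1
  simp only [h1] at h
  rw [h]
  congr 1
  · simp [Nat.card_eq_fintype_card]
  · refine Finset.sum_congr rfl fun x _ => ?_
    rw [Finset.sum_eq_single x]
    · simp [sq]
    · intro b _ hb; simp [hb]
    · simp

open scoped Classical in
lemma fourier_proj {l : ℕ} (N : Submodule R (Fin l → R)) (ν : (Fin l → R) → ℝ)
    (χ : Fin l → AddChar R ℂ) :
    fourier (proj N ν) χ = if ∀ y ∈ N, dualChar χ y = 1 then fourier ν χ else 0 := by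
  have hN : (Nat.card N : ℂ) ≠ 0 := Nat.cast_ne_zero.2 Nat.card_pos.ne'
  have h1 : fourier (proj N ν) χ * Nat.card N =
      ∑ y : N, ∑ x, (ν (x + y) : ℂ) * dualChar χ x := by
    unfold fourier proj
    rw [Finset.sum_comm, Finset.sum_mul]
    refine Finset.sum_congr rfl fun x _ => ?_
    rw [finsum_eq_sum_of_fintype, ← Finset.sum_mul]
    push_cast
    field_simp
  have h2 : ∀ y : N, ∑ x, (ν (x + y) : ℂ) * dualChar χ x =
      fourier ν χ * dualChar χ ((-y : N) : Fin l → R) := by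
    intro y
    unfold fourier
    rw [Finset.sum_mul]
    refine Fintype.sum_equiv (Equiv.addRight (y : Fin l → R)) _ _ fun x => ?_
    rw [mul_assoc, ← AddChar.map_add_eq_mul]
    simp
  simp only [h2] at h1
  have h3 := Equiv.sum_comp (Equiv.neg N) (fun y : N => dualChar χ (y : Fin l → R))
  simp only [Equiv.neg_apply] at h3
  have h4 := sum_addSubgroup_addChar N.toAddSubgroup (dualChar χ)
  rw [← Finset.mul_sum, h3] at h1
  have h5 : ∑ y : N, dualChar χ (y : Fin l → R) =
      if ∀ y ∈ N, dualChar χ y = 1 then (Nat.card N : ℂ) else 0 := h4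
  rw [h5] at h1
  split_ifs at h1 ⊢
  · exact mul_right_cancel₀ hN h1
  · rw [mul_zero] at h1
    exact (mul_eq_zero.1 h1).resolve_right hN

open scoped Classical in
-- The factor `|R^l|` lost to Cauchy–Schwarz is the one in Parseval, and averaging over `N` kills
-- the characters nontrivial on `N`.
lemma l1Norm_proj_le_sqrt {l : ℕ} (N : Submodule R (Fin l → R)) (ν : (Fin l → R) → ℝ) :
    l1Norm (proj N ν) ≤
      √(∑ χ : Fin l → AddChar R ℂ with ∀ y ∈ N, dualChar χ y = 1, ‖fourier ν χ‖ ^ 2) := by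
  refine Real.le_sqrt_of_sq_le ?_
  rw [l1Norm_eq_sum, Finset.sum_filter]
  have h := sum_norm_fourier_sq_univ (proj N ν)
  simp only [fourier_proj] at h
  calc (∑ x, |proj N ν x|) ^ 2 ≤ _ := sq_sum_le_card_mul_sum_sq
    _ = _ := by
      simp only [sq_abs]
      rw [Finset.card_univ, ← h]
      refine Finset.sum_congr rfl fun χ _ => ?_
      split_ifs <;> simp

lemma l1Norm_proj_le {l : ℕ} (N : Submodule R (Fin l → R)) (ν : (Fin l → R) → ℝ) :
    l1Norm (proj N ν) ≤ l1Norm ν := by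
  classical
  have hN : (0 : ℝ) < Nat.card N := Nat.cast_pos.2 Nat.card_pos
  rw [l1Norm_eq_sum, l1Norm_eq_sum]
  have h1 : ∀ x, |proj N ν x| ≤ (∑ y : N, |ν (x + y)|) / Nat.card N := by
    intro x
    unfold proj
    rw [finsum_eq_sum_of_fintype, abs_div, Nat.abs_cast]
    exact div_le_div_of_nonneg_right (Finset.abs_sum_le_sum_abs _ _) hN.le
  refine (Finset.sum_le_sum fun x _ => h1 x).trans ?_
  rw [← Finset.sum_div, Finset.sum_comm, div_le_iff₀ hN]
  have h2 : ∀ y : N, ∑ x, |ν (x + y)| = ∑ x, |ν x| := fun y =>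
    Fintype.sum_equiv (Equiv.addRight (y : Fin l → R)) _ _ fun x => rfl
  simp only [h2]
  rw [Finset.sum_const, nsmul_eq_mul, Finset.card_univ, Nat.card_eq_fintype_card, mul_comm]

open scoped Classical in
lemma sum_matrix_eq_hitProb_pow (p : R → ℝ) {A : Type*} [AddCommGroup A] [Module R A]
    {l : ℕ} (k : ℕ) (χ : Fin l → A) :
    ∑ M : Matrix (Fin l) (Fin k) R, (∏ i, ∏ j, p (M i j)) *
      (if ∀ j, ∑ i, M i j • χ i = 0 then 1 else 0) = hitProb p χ {0} ^ k := by
  unfold hitProb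
  rw [Fintype.sum_pow]
  refine Fintype.sum_equiv (Equiv.piComm fun (_ : Fin l) (_ : Fin k) => R) _ _ fun M => ?_
  rw [Finset.prod_mul_distrib, Finset.prod_comm]
  simp only [Set.mem_singleton_iff, Equiv.piComm_apply, Function.swap]
  congr 1
  split_ifs with h
  · simp [h]
  · push Not at h
    obtain ⟨j, hj⟩ := h
    exact (Finset.prod_eq_zero (mem_univ j) (if_neg hj)).symm

end Dual

/-! ### The two bounds on the hitting probability -/

section Bounds

variable {R : Type*} [CommRing R] [Fintype R] [IsLocalRing R]
  {A : Type*} [AddCommGroup A] [Module R A] [Fintype A]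

/-- `χ` lies in `K^l` and `K` is a submodule. -/
def IsGeneric (R : Type*) [CommRing R] {A : Type*} [AddCommGroup A] [Module R A]
    (K : AddSubgroup A) {l : ℕ} (χ : Fin l → A) : Prop :=
  (∀ r : R, ∀ κ ∈ K, r • κ ∈ K) ∧ ∀ i, χ i ∈ K

open scoped Classical in
lemma hitProb_zero_bounds {p : R → ℝ} (hp : ∀ r, 0 ≤ p r) (hp1 : ∑ r, p r = 1)
    (hT : ∀ (I : Ideal R) (a : R), I ≠ ⊤ → ¬ ∀ r ∈ {r | p r ≠ 0}, ∃ s ∈ I, r = a + s)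
    (hT' : ∀ (S : Subring R) (a : R) (c : Rˣ), S ≠ ⊤ →
      ¬ ∀ r ∈ {r | p r ≠ 0}, ∃ s ∈ S, r = a + c * s)
    {α δ ρ β η : ℝ} (hδ : ∀ (ψ : AddChar A ℂ) (a b : A), ψ a ≠ ψ b → ‖ψ a + ψ b‖ ≤ δ)
    (hα : 0 ≤ α) (hαp : ∀ r, p r ≠ 0 → α ≤ p r) (hρ0 : 0 ≤ ρ) (hρ1 : ρ ≤ 1)
    (hρ : 1 - α * (2 - δ) ≤ ρ)
    (hβ : ∀ x, ∑ r with IsLocalRing.residue R r = x, p r ≤ β) (hβ1 : β ≤ 1)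
    {q n : ℕ} (hq : q.Prime) (hA : ∀ a : A, q ^ n • a = 0) (hqβ : 1 / (q : ℝ) ≤ β) (hη : 0 ≤ η)
    {s : ℕ} (hs : ρ ^ s ≤ η / (q * Fintype.card A)) {l : ℕ} {χ : Fin l → A}
    {K : AddSubgroup A} (hK : IsRobust s K χ) :
    hitProb p χ {0} ≤ (1 + η) / Nat.card K ∧
      (¬ IsGeneric R K χ → hitProb p χ {0} ≤ (1 + η) * β / Nat.card K) := by
  have hK0 : (0 : ℝ) < Nat.card K := Nat.cast_pos.2 Nat.card_pos
  have hq0 : (0 : ℝ) < q := Nat.cast_pos.2 hq.pos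
  have hKA : (Nat.card K : ℝ) ≤ Fintype.card A := by
    rw [← Nat.card_eq_fintype_card]
    exact_mod_cast AddSubgroup.card_le_card_addGroup K
  -- As `1 / q ≤ β`, the Fourier error is small even against the improved bound `β / |K|`.
  have hs' : ρ ^ s ≤ η * β / Nat.card K := by
    calc ρ ^ s ≤ η / (q * Fintype.card A) := hs
      _ ≤ η / (q * Nat.card K) := by gcongr
      _ = η * (1 / q) / Nat.card K := by field_simp
      _ ≤ η * β / Nat.card K := by gcongr
  have hβη : (1 + η) * β / Nat.card K ≤ (1 + η) / Nat.card K := by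
    gcongr
    exact mul_le_of_le_one_right (by linarith) hβ1
  rcases diffSpan_dichotomy hT hT' hq hA K with ⟨hstab, hle⟩ | hlarge
  · have h1 := hitProb_zero_le_of_isRobust hp hp1 hδ hα hαp hρ0 hρ1 hρ hK hle
    constructor
    · have h2 := hitProb_le_one hp hp1 χ (K : Set A)
      calc hitProb p χ {0} ≤ hitProb p χ K / Nat.card K + ρ ^ s := h1
        _ ≤ 1 / Nat.card K + η * β / Nat.card K := by gcongr
        _ ≤ 1 / Nat.card K + η / Nat.card K := by
          gcongr
          exact mul_le_of_le_one_right hη hβ1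
        _ = _ := by ring
    · intro hg
      have h2 : ∃ i, χ i ∉ K := by
        by_contra! h
        exact hg ⟨hstab, h⟩
      obtain ⟨i, hi⟩ := h2
      have h3 := hitProb_le_of_notMem hp hp1 hβ hstab hi
      calc hitProb p χ {0} ≤ hitProb p χ K / Nat.card K + ρ ^ s := h1
        _ ≤ β / Nat.card K + η * β / Nat.card K := by gcongr
        _ = _ := by ring
  · have h1 := hitProb_zero_le_of_isRobust hp hp1 hδ hα hαp hρ0 hρ1 hρ hK le_rfl
    have h2 : hitProb p χ {0} ≤ (1 + η) * β / Nat.card K := by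
      have h3 := hitProb_le_one hp hp1 χ (diffSpan {r | p r ≠ 0} K : Set A)
      have h4 : (q : ℝ) * Nat.card K ≤ Nat.card (diffSpan {r | p r ≠ 0} K) := by
        exact_mod_cast hlarge
      calc hitProb p χ {0} ≤ 1 / Nat.card (diffSpan {r | p r ≠ 0} K) + ρ ^ s :=
            h1.trans (by gcongr)
        _ ≤ 1 / (q * Nat.card K) + η * β / Nat.card K := by gcongr
        _ = (1 / q) / Nat.card K + η * β / Nat.card K := by field_simp
        _ ≤ β / Nat.card K + η * β / Nat.card K := by gcongr
        _ = _ := by ring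
    exact ⟨h2.trans hβη, fun _ => h2⟩

lemma sum_matrix_weight_eq_one {p : R → ℝ} (hp1 : ∑ r, p r = 1) (l k : ℕ) :
    ∑ M : Matrix (Fin l) (Fin k) R, ∏ i, ∏ j, p (M i j) = 1 := by
  classical
  -- At `χ = 0` the hitting event is certain.
  have h := sum_matrix_eq_hitProb_pow p k (fun _ : Fin l => (0 : R))
  simpa [hitProb, sum_prod_eq_one hp1] using h

end Bounds

/-! ### Averaging the projection bound over the random matrix -/

section Expectation

variable {R : Type*} [CommRing R] [Fintype R]

open scoped Classical in
-- If some `χ` outside `G` annihilates `im M`, the first sum is at least `1` and contraction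
-- suffices. If not, Parseval involves only `χ` in `G`, grouped by `Kf`.
lemma l1Norm_proj_matrixImage_le {l k : ℕ} (M : Matrix (Fin l) (Fin k) R) (ν : (Fin l → R) → ℝ)
    (Kf : (Fin l → AddChar R ℂ) → AddSubgroup (AddChar R ℂ)) (G : (Fin l → AddChar R ℂ) → Prop) :
    l1Norm (proj (matrixImage M) ν) ≤
      (∑ χ with ¬ G χ, if ∀ j, ∑ i, M i j • χ i = 0 then (1 : ℝ) else 0) * l1Norm ν +
      ∑ K, √(∑ χ with G χ ∧ Kf χ = K,
        (if ∀ j, ∑ i, M i j • χ i = 0 then (1 : ℝ) else 0) * ‖fourier ν χ‖ ^ 2) := by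
  by_cases h : ∃ χ, ¬ G χ ∧ ∀ j, ∑ i, M i j • χ i = 0
  · obtain ⟨χ, hχ, hM⟩ := h
    have h1 : (1 : ℝ) ≤ ∑ χ with ¬ G χ, if ∀ j, ∑ i, M i j • χ i = 0 then (1 : ℝ) else 0 := by
      refine le_trans (le_of_eq (if_pos hM).symm) (Finset.single_le_sum
        (f := fun χ => if ∀ j, ∑ i, M i j • χ i = 0 then (1 : ℝ) else 0)
        (fun χ _ => by split_ifs <;> norm_num) (mem_filter.2 ⟨mem_univ χ, hχ⟩))
    refine (l1Norm_proj_le _ ν).trans ?_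
    have h2 : l1Norm ν ≤ (∑ χ with ¬ G χ, if ∀ j, ∑ i, M i j • χ i = 0 then (1 : ℝ) else 0) *
        l1Norm ν := le_mul_of_one_le_left (l1Norm_nonneg ν) h1
    exact h2.trans (le_add_of_nonneg_right (Finset.sum_nonneg fun _ _ => Real.sqrt_nonneg _))
  · push Not at h
    have h0 : 0 ≤ (∑ χ with ¬ G χ, if ∀ j, ∑ i, M i j • χ i = 0 then (1 : ℝ) else 0) * l1Norm ν :=
      mul_nonneg (Finset.sum_nonneg fun χ _ => by split_ifs <;> norm_num) (l1Norm_nonneg ν)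
    refine (l1Norm_proj_le_sqrt _ ν).trans (le_trans ?_ (le_add_of_nonneg_left h0))
    refine Real.sqrt_le_iff.2 ⟨Finset.sum_nonneg fun _ _ => Real.sqrt_nonneg _, ?_⟩
    refine le_trans ?_ (Finset.sum_sq_le_sq_sum_of_nonneg fun _ _ => Real.sqrt_nonneg _)
    have hnn : ∀ χ : Fin l → AddChar R ℂ,
        0 ≤ (if ∀ j, ∑ i, M i j • χ i = 0 then (1 : ℝ) else 0) * ‖fourier ν χ‖ ^ 2 := fun χ =>
      mul_nonneg (by split_ifs <;> norm_num) (sq_nonneg _)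
    simp only [Real.sq_sqrt (Finset.sum_nonneg fun χ _ => hnn χ)]
    have h3 : ∀ K, ∑ χ with G χ ∧ Kf χ = K,
        (if ∀ j, ∑ i, M i j • χ i = 0 then (1 : ℝ) else 0) * ‖fourier ν χ‖ ^ 2 =
        ∑ χ with Kf χ = K,
          (if ∀ j, ∑ i, M i j • χ i = 0 then (1 : ℝ) else 0) * ‖fourier ν χ‖ ^ 2 := by
      intro K
      refine Finset.sum_subset (fun χ hχ => ?_) fun χ hχ hχ' => ?_
      · simp only [mem_filter, mem_univ, true_and] at hχ ⊢
        exact hχ.2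
      · simp only [mem_filter, mem_univ, true_and] at hχ hχ'
        have hG : ¬ G χ := fun hG => hχ' ⟨hG, hχ⟩
        rw [if_neg, zero_mul]
        intro hcon
        obtain ⟨j, hj⟩ := h χ hG
        exact hj (hcon j)
    simp only [h3]
    have h4 := Finset.sum_fiberwise univ Kf fun χ : Fin l → AddChar R ℂ =>
      (if ∀ j, ∑ i, M i j • χ i = 0 then (1 : ℝ) else 0) * ‖fourier ν χ‖ ^ 2
    refine le_of_eq (Eq.trans ?_ (h4.symm.trans (by congr!)))
    rw [Finset.sum_filter]
    refine Finset.sum_congr rfl fun χ _ => ?_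
    simp only [dualChar_matrixImage_iff]
    split_ifs <;> simp

lemma sum_mul_sqrt_le {ι : Type*} [Fintype ι] {W S : ι → ℝ} (hW : ∀ i, 0 ≤ W i)
    (hW1 : ∑ i, W i = 1) (hS : ∀ i, 0 ≤ S i) : ∑ i, W i * √(S i) ≤ √(∑ i, W i * S i) := by
  have h := Real.sum_sqrt_mul_sqrt_le univ hW (g := fun i => W i * S i)
    fun i => mul_nonneg (hW i) (hS i)
  rw [hW1, Real.sqrt_one, one_mul] at h
  refine le_trans (le_of_eq (Finset.sum_congr rfl fun i _ => ?_)) h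
  rw [Real.sqrt_mul (hW i), ← mul_assoc, Real.mul_self_sqrt (hW i)]

open scoped Classical in
lemma sum_l1Norm_proj_matrixImage_le [IsLocalRing R] {p : R → ℝ} (hp : ∀ r, 0 ≤ p r)
    (hp1 : ∑ r, p r = 1) {l : ℕ} (k : ℕ) (ν : (Fin l → R) → ℝ)
    (Kf : (Fin l → AddChar R ℂ) → AddSubgroup (AddChar R ℂ)) (G : (Fin l → AddChar R ℂ) → Prop) :
    ∑ M : Matrix (Fin l) (Fin k) R, (∏ i, ∏ j, p (M i j)) * l1Norm (proj (matrixImage M) ν) ≤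
      (∑ χ with ¬ G χ, hitProb p χ {0} ^ k) * l1Norm ν +
      ∑ K, √(∑ χ with G χ ∧ Kf χ = K, hitProb p χ {0} ^ k * ‖fourier ν χ‖ ^ 2) := by
  have hW : ∀ M : Matrix (Fin l) (Fin k) R, 0 ≤ ∏ i, ∏ j, p (M i j) := fun M =>
    Finset.prod_nonneg fun i _ => Finset.prod_nonneg fun j _ => hp _
  refine (Finset.sum_le_sum fun M _ => mul_le_mul_of_nonneg_left
    (l1Norm_proj_matrixImage_le M ν Kf G) (hW M)).trans ?_
  simp only [mul_add, Finset.sum_add_distrib, ← mul_assoc]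
  refine add_le_add (le_of_eq ?_) ?_
  · rw [← Finset.sum_mul]
    congr 1
    simp only [Finset.mul_sum]
    rw [Finset.sum_comm]
    exact Finset.sum_congr rfl fun χ _ => sum_matrix_eq_hitProb_pow p k χ
  · simp only [Finset.mul_sum]
    rw [Finset.sum_comm]
    refine Finset.sum_le_sum fun K _ => ?_
    refine (sum_mul_sqrt_le hW (sum_matrix_weight_eq_one hp1 l k) fun M =>
      Finset.sum_nonneg fun χ _ => mul_nonneg (by split_ifs <;> norm_num) (sq_nonneg _)).trans
      (le_of_eq ?_)
    congr 1
    simp only [Finset.mul_sum, ← mul_assoc]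
    rw [Finset.sum_comm]
    refine Finset.sum_congr rfl fun χ _ => ?_
    rw [← Finset.sum_mul, sum_matrix_eq_hitProb_pow]

end Expectation

/-! ### Summation over robust subgroups -/

section Main

variable {R : Type*} [CommRing R] [Fintype R]

/-- Cancels the `|K|^l` vectors against the `|K|^(-k)` probability; the mismatch of exponents costs
a constant `a ^ w`. -/
lemma pow_mul_div_pow_le {κ a B : ℝ} (hκ : 1 ≤ κ) (hκa : κ ≤ a) (hB : 0 ≤ B) {l k w : ℕ}
    (hl : l ≤ k + w) : κ ^ l * (B / κ) ^ k ≤ a ^ w * B ^ k := by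
  have h0 : 0 < κ := by linarith
  calc κ ^ l * (B / κ) ^ k ≤ κ ^ (k + w) * (B / κ) ^ k :=
        mul_le_mul_of_nonneg_right (pow_le_pow_right₀ hκ hl) (by positivity)
    _ = κ ^ w * B ^ k := by rw [div_pow, pow_add]; field_simp
    _ ≤ a ^ w * B ^ k := by gcongr

open scoped Classical in
lemma sum_l1Norm_proj_le_of_bounds [IsLocalRing R] {p : R → ℝ} (hp : ∀ r, 0 ≤ p r)
    (hp1 : ∑ r, p r = 1) {β η q : ℝ} (hβ0 : 0 ≤ β) (hβ1 : β ≤ 1) (hη : 0 ≤ η) (hq : 1 ≤ q * β)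
    {l k s w : ℕ} (hl : l ≤ k + w) (hk : k ≤ l + w)
    (hbd : ∀ (K : AddSubgroup (AddChar R ℂ)) (χ : Fin l → AddChar R ℂ), IsRobust s K χ →
      hitProb p χ {0} ≤ (1 + η) / Nat.card K ∧
        (¬ IsGeneric R K χ → hitProb p χ {0} ≤ (1 + η) * β / Nat.card K))
    (hcount : ∀ K : AddSubgroup (AddChar R ℂ),
      (#{χ : Fin l → AddChar R ℂ | offCount K χ ≤ s * Fintype.card (AddChar R ℂ)} : ℝ) ≤
        (Nat.card K : ℝ) ^ l * (1 + η) ^ (2 * l)) (ν : (Fin l → R) → ℝ) :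
    ∑ M : Matrix (Fin l) (Fin k) R, (∏ i, ∏ j, p (M i j)) * l1Norm (proj (matrixImage M) ν) ≤
      Fintype.card (AddSubgroup (AddChar R ℂ)) * ((1 + η) ^ (l + w) *
        Fintype.card (AddChar R ℂ) ^ w * ∑ I : Ideal R, l2Norm (modIdeal I ν)) +
      Fintype.card (AddSubgroup (AddChar R ℂ)) * ((1 + η) ^ (3 * l + w) *
        Fintype.card (AddChar R ℂ) ^ w * q ^ w * β ^ l) * l1Norm ν := by
  choose Kf hKf using fun χ : Fin l → AddChar R ℂ => exists_isRobust s χ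
  set a : ℝ := (Fintype.card (AddChar R ℂ) : ℝ) with ha
  have hK1 : ∀ K : AddSubgroup (AddChar R ℂ), (1 : ℝ) ≤ Nat.card K := fun K =>
    Nat.one_le_cast.2 Nat.card_pos
  have hKa : ∀ K : AddSubgroup (AddChar R ℂ), (Nat.card K : ℝ) ≤ a := fun K => by
    rw [ha, ← Nat.card_eq_fintype_card]
    exact_mod_cast AddSubgroup.card_le_card_addGroup K
  have ha1 : 1 ≤ a := (hK1 ⊥).trans (hKa ⊥)
  have hη1 : 1 ≤ 1 + η := by linarith
  have hηk : (1 + η) ^ k ≤ (1 + η) ^ (l + w) := pow_le_pow_right₀ hη1 hk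
  have hq0 : 0 ≤ q := by
    by_contra! h
    nlinarith
  -- When `k < l` the missing powers of `β` are paid for by `q * β ≥ 1`.
  have hβk : β ^ k ≤ q ^ w * β ^ l := by
    calc β ^ k ≤ β ^ k * (q * β) ^ w := le_mul_of_one_le_right (pow_nonneg hβ0 k) (one_le_pow₀ hq)
      _ = q ^ w * β ^ (k + w) := by rw [mul_pow, pow_add]; ring
      _ ≤ q ^ w * β ^ l := by
        gcongr q ^ w * ?_
        exact pow_le_pow_of_le_one hβ0 hβ1 hl
  refine (sum_l1Norm_proj_matrixImage_le hp hp1 k ν Kf fun χ => IsGeneric R (Kf χ) χ).trans ?_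
  rw [add_comm]
  have hpow : ∀ χ : Fin l → AddChar R ℂ, 0 ≤ hitProb p χ {0} ^ k := fun χ =>
    pow_nonneg (hitProb_nonneg hp _ _) k
  refine add_le_add ?_ (mul_le_mul_of_nonneg_right ?_ (l1Norm_nonneg ν))
  · rw [← nsmul_eq_mul, ← Finset.card_univ]
    refine Finset.sum_le_card_nsmul _ _ _ fun K _ => ?_
    have hL : 0 ≤ ∑ I : Ideal R, l2Norm (modIdeal I ν) :=
      Finset.sum_nonneg fun I _ => Real.sqrt_nonneg _
    by_cases hK : ∀ r : R, ∀ ψ ∈ K, r • ψ ∈ K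
    · have h1 : ∑ χ with IsGeneric R (Kf χ) χ ∧ Kf χ = K,
          hitProb p χ {0} ^ k * ‖fourier ν χ‖ ^ 2 ≤
          -- The prefactor is at least `1`, so squaring it is harmless and leaves a perfect square
          -- under the root.
          ((1 + η) ^ (l + w) * a ^ w * l2Norm (modIdeal (annIdeal K hK) ν)) ^ 2 := by
        calc _ ≤ ∑ χ with IsGeneric R (Kf χ) χ ∧ Kf χ = K,
              ((1 + η) / Nat.card K) ^ k * ‖fourier ν χ‖ ^ 2 := by
              refine Finset.sum_le_sum fun χ hχ => ?_
              have h2 := (mem_filter.1 hχ).2.2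
              have h3 := (hbd K χ (h2 ▸ hKf χ)).1
              gcongr
              exact hitProb_nonneg hp _ _
          _ ≤ ∑ χ : Fin l → AddChar R ℂ with ∀ i, χ i ∈ K,
              ((1 + η) / Nat.card K) ^ k * ‖fourier ν χ‖ ^ 2 := by
              refine Finset.sum_le_sum_of_subset_of_nonneg (fun χ hχ => ?_)
                fun χ _ _ => by positivity
              simp only [mem_filter, mem_univ, true_and] at hχ ⊢
              exact hχ.2 ▸ hχ.1.2
          _ = ((Nat.card K : ℝ) ^ l * ((1 + η) / Nat.card K) ^ k) *
              l2Norm (modIdeal (annIdeal K hK) ν) ^ 2 := by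
              rw [← Finset.mul_sum, sum_norm_fourier_sq_eq_l2Norm K hK]; ring
          _ ≤ ((1 + η) ^ (l + w) * a ^ w) ^ 2 * l2Norm (modIdeal (annIdeal K hK) ν) ^ 2 := by
              gcongr
              refine (pow_mul_div_pow_le (hK1 K) (hKa K) (by linarith) hl).trans ?_
              have h4 : 1 ≤ (1 + η) ^ (l + w) * a ^ w :=
                one_le_mul_of_one_le_of_one_le (one_le_pow₀ hη1) (one_le_pow₀ ha1)
              calc a ^ w * (1 + η) ^ k ≤ a ^ w * (1 + η) ^ (l + w) := by gcongr
                _ = (1 + η) ^ (l + w) * a ^ w := mul_comm _ _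
                _ ≤ _ := le_self_pow₀ h4 two_ne_zero
          _ = _ := by ring
      refine (Real.sqrt_le_sqrt h1).trans ?_
      have hl2 : 0 ≤ l2Norm (modIdeal (annIdeal K hK) ν) := Real.sqrt_nonneg _
      rw [Real.sqrt_sq (by positivity)]
      gcongr
      exact Finset.single_le_sum (f := fun I : Ideal R => l2Norm (modIdeal I ν))
        (fun I _ => Real.sqrt_nonneg _) (mem_univ _)
    · rw [Finset.filter_false_of_mem, Finset.sum_empty, Real.sqrt_zero]
      · positivity
      · rintro χ - ⟨h1, h2⟩
        exact hK (h2 ▸ h1.1)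
  · have h1 := Finset.sum_fiberwise (univ.filter fun χ => ¬ IsGeneric R (Kf χ) χ) Kf
      fun χ => hitProb p χ {0} ^ k
    refine le_trans (le_of_eq h1.symm) ?_
    rw [← nsmul_eq_mul, ← Finset.card_univ]
    refine Finset.sum_le_card_nsmul _ _ _ fun K _ => ?_
    rw [Finset.filter_filter]
    calc _ ≤ ∑ χ with ¬ IsGeneric R (Kf χ) χ ∧ Kf χ = K, ((1 + η) * β / Nat.card K) ^ k := by
          refine Finset.sum_le_sum fun χ hχ => ?_
          have h2 := (mem_filter.1 hχ).2
          have h3 := (hbd K χ (h2.2 ▸ hKf χ)).2 (h2.2 ▸ h2.1)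
          exact pow_le_pow_left₀ (hitProb_nonneg hp _ _) h3 k
      _ ≤ ∑ χ : Fin l → AddChar R ℂ with offCount K χ ≤ s * Fintype.card (AddChar R ℂ),
          ((1 + η) * β / Nat.card K) ^ k := by
          refine Finset.sum_le_sum_of_subset_of_nonneg (fun χ hχ => ?_)
            fun χ _ _ => by positivity
          simp only [mem_filter, mem_univ, true_and] at hχ ⊢
          exact hχ.2 ▸ (hKf χ).1
      _ ≤ ((Nat.card K : ℝ) ^ l * (1 + η) ^ (2 * l)) * ((1 + η) * β / Nat.card K) ^ k := by
          rw [Finset.sum_const, nsmul_eq_mul]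
          exact mul_le_mul_of_nonneg_right (hcount K) (by positivity)
      _ = (1 + η) ^ (2 * l) * ((Nat.card K : ℝ) ^ l * ((1 + η) * β / Nat.card K) ^ k) := by ring
      _ ≤ (1 + η) ^ (2 * l) * (a ^ w * ((1 + η) * β) ^ k) := by
          gcongr (1 + η) ^ (2 * l) * ?_
          exact pow_mul_div_pow_le (hK1 K) (hKa K) (by positivity) hl
      _ = (1 + η) ^ (2 * l) * (a ^ w * ((1 + η) ^ k * β ^ k)) := by rw [mul_pow]
      _ ≤ (1 + η) ^ (2 * l) * (a ^ w * ((1 + η) ^ (l + w) * (q ^ w * β ^ l))) := by gcongr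
      _ = _ := by rw [show 3 * l + w = 2 * l + (l + w) by ring, pow_add (1 + η) (2 * l)]; ring

/-- For a small enough proportion `1 / n` of exceptional coordinates, the number of vectors
lying almost entirely in `K` is at most `|K|^l` up to a small exponential factor. -/
lemma exists_card_offCount_le (A : Type*) [AddCommGroup A] [Fintype A] {η : ℝ} (hη : 0 < η)
    (hη1 : η ≤ 1) : ∃ n : ℕ, 0 < n ∧ ∀ (l : ℕ) (K : AddSubgroup A), by classical exact
      (#{χ : Fin l → A | offCount K χ ≤ l / n * Fintype.card A} : ℝ) ≤
        (Nat.card K : ℝ) ^ l * (1 + η) ^ (2 * l) := by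
  classical
  have ha : (1 : ℝ) ≤ Fintype.card A := Nat.one_le_cast.2 Fintype.card_pos
  set a := Fintype.card A with ha'
  -- This makes `|K| + z * a = |K| + η ≤ |K| (1 + η)`. The remaining `z ^ (-(s * a))` is at most `(1
  -- + η) ^ l` once `s` is a small enough proportion of `l`.
  let z : ℝ := η / a
  have hz : 0 < z := by positivity
  have hz1 : z ≤ 1 := (div_le_one (by positivity)).2 (hη1.trans ha)
  obtain ⟨n, hn⟩ := pow_unbounded_of_one_lt (1 / z ^ a) (show 1 < 1 + η by linarith)
  have hn' : 1 ≤ z ^ a * (1 + η) ^ (n + 1) := by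
    rw [div_lt_iff₀ (by positivity)] at hn
    have : (1 + η) ^ n ≤ (1 + η) ^ (n + 1) := pow_le_pow_right₀ (by linarith) n.le_succ
    nlinarith [pow_pos hz a]
  refine ⟨n + 1, n.succ_pos, fun l K => ?_⟩
  set s := l / (n + 1)
  have hs : (n + 1) * s ≤ l := Nat.mul_div_le l (n + 1)
  have hK : (1 : ℝ) ≤ Nat.card K := Nat.one_le_cast.2 Nat.card_pos
  have h1 := card_offCount_le_mul_pow K l (s * a) hz.le hz1
  have h2 : (Nat.card K + z * a : ℝ) ≤ Nat.card K * (1 + η) := by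
    have : z * a = η := by simp only [z]; field_simp
    rw [this]; nlinarith
  have h3 : 1 ≤ z ^ (s * a) * (1 + η) ^ l := by
    calc (1 : ℝ) ≤ (z ^ a * (1 + η) ^ (n + 1)) ^ s := one_le_pow₀ hn'
      _ = z ^ (s * a) * (1 + η) ^ ((n + 1) * s) := by
        rw [mul_pow, ← pow_mul, ← pow_mul, mul_comm a s]
      _ ≤ z ^ (s * a) * (1 + η) ^ l := by
        gcongr z ^ (s * a) * ?_
        exact pow_le_pow_right₀ (by linarith) hs
  set N : ℝ := (#{χ : Fin l → A | offCount K χ ≤ s * a} : ℝ) with hN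
  have hN0 : 0 ≤ N := Nat.cast_nonneg _
  calc N ≤ N * (z ^ (s * a) * (1 + η) ^ l) := le_mul_of_one_le_right hN0 h3
    _ = N * z ^ (s * a) * (1 + η) ^ l := by ring
    _ ≤ (Nat.card K + z * a) ^ l * (1 + η) ^ l := by gcongr
    _ ≤ (Nat.card K * (1 + η)) ^ l * (1 + η) ^ l := by gcongr
    _ = _ := by rw [mul_pow, two_mul, pow_add]; ring

end Main

/-! ### Residue characteristic and residue law -/

section LocalRing

variable {R : Type*} [CommRing R] [Finite R] [IsLocalRing R]

variable (R) in
lemma ringChar_residueField_prime : (ringChar (IsLocalRing.ResidueField R)).Prime := by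
  have : Finite (IsLocalRing.ResidueField R) :=
    Finite.of_surjective _ (IsLocalRing.residue_surjective (R := R))
  exact (CharP.char_is_prime_or_zero (IsLocalRing.ResidueField R) _).resolve_right
    (CharP.char_ne_zero_of_finite (IsLocalRing.ResidueField R) _)

/-- The residue characteristic lies in the maximal ideal, which is nilpotent. -/
lemma exists_ringChar_residueField_pow_nsmul_eq_zero (R : Type*) [CommRing R] [Finite R]
    [IsLocalRing R] (A : Type*) [AddCommGroup A] [Module R A] :
    ∃ n, ∀ a : A, ringChar (IsLocalRing.ResidueField R) ^ n • a = 0 := by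
  set q := ringChar (IsLocalRing.ResidueField R)
  have h1 : (q : R) ∈ IsLocalRing.maximalIdeal R := by
    rw [← IsLocalRing.residue_eq_zero_iff, map_natCast]
    exact ringChar.Nat.cast_ringChar
  obtain ⟨n, hn⟩ := IsArtinianRing.isNilpotent_jacobson_bot (R := R)
  rw [IsLocalRing.jacobson_eq_maximalIdeal _ bot_ne_top] at hn
  refine ⟨n, fun a => ?_⟩
  have h2 : (q : R) ^ n = 0 := by
    have := Ideal.pow_mem_pow h1 n
    rw [hn] at this
    exact this
  rw [← Nat.cast_smul_eq_nsmul R, Nat.cast_pow, h2, zero_smul]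

lemma sum_fiber_le_residueLinf [Fintype R] (ξ : PMF R) (x : IsLocalRing.ResidueField R) :
    by classical exact
      ∑ r with IsLocalRing.residue R r = x, (ξ r).toReal ≤ residueLinf ξ := by
  classical
  have : Finite (IsLocalRing.ResidueField R) :=
    Finite.of_surjective _ (IsLocalRing.residue_surjective (R := R))
  have h1 : ∑ r with IsLocalRing.residue R r = x, (ξ r).toReal =
      (ξ.map (IsLocalRing.residue R) x).toReal := by
    rw [PMF.map_apply, tsum_fintype, ENNReal.toReal_sum, Finset.sum_filter]
    · refine Finset.sum_congr rfl fun r _ => ?_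
      by_cases h : IsLocalRing.residue R r = x
      · simp [h]
      · simp [h, Ne.symm h]
    · intro r _
      split_ifs
      · exact ξ.apply_ne_top r
      · simp
  rw [h1]
  exact le_ciSup (f := fun x => (ξ.map (IsLocalRing.residue R) x).toReal)
    (Set.finite_range _).bddAbove x

lemma maxBound_le_one (ξ : PMF R) : maxBound ξ ≤ 1 := by
  refine max_le ?_ ?_
  · rw [div_le_one (Nat.cast_pos.2 (ringChar_residueField_prime R).pos)]
    exact Nat.one_le_cast.2 (ringChar_residueField_prime R).one_le
  · exact ciSup_le fun x => ENNReal.toReal_le_of_le_ofReal zero_le_one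
      (by rw [ENNReal.ofReal_one]; exact PMF.coe_le_one _ x)

end LocalRing

end ColumnSwap

end

/-! ### Choice of constants and conclusion -/

theorem mainTheorem7 {R : Type*} [CommRing R] [Finite R] [IsLocalRing R]
    (u : ℤ) (ε : ℝ) (hε : 0 < ε) (α : ℝ) :
    ∃ C : ℝ, ∀ ξ : PMF R,
      ColumnSwap.NotOnIdealTranslate ξ →
      ColumnSwap.NotOnSubringTranslate ξ →
      IsLeast ((fun r => (ξ r).toReal) '' ξ.support) α →
      ∀ l k : ℕ, (k : ℤ) = (l : ℤ) + u →
      ∀ ν : (Fin l → R) → ℝ,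
        ∑ᶠ M : Matrix (Fin l) (Fin k) R,
            ColumnSwap.iidMatrixProb ξ M *
              ColumnSwap.l1Norm (ColumnSwap.proj (ColumnSwap.matrixImage M) ν) ≤
          (∑ᶠ I : Ideal R, C * ((1 + ε) ^ l * ColumnSwap.l2Norm (ColumnSwap.modIdeal I ν))) +
            C * ((1 + ε) ^ l * ColumnSwap.maxBound ξ ^ l * ColumnSwap.l1Norm ν) := by
  classical
  have := Fintype.ofFinite R
  by_cases hα : 0 < α
  swap
  -- An attained minimum over the support is positive, so no `ξ` qualifies.
  · refine ⟨0, fun ξ _ _ hmin => (hα ?_).elim⟩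
    obtain ⟨r, hr, hrα⟩ := hmin.1
    rw [← hrα]
    exact ENNReal.toReal_pos ((PMF.mem_support_iff _ _).1 hr) (ξ.apply_ne_top r)
  set q := ringChar (IsLocalRing.ResidueField R) with hq_def
  have hq : q.Prime := ColumnSwap.ringChar_residueField_prime R
  have hq1 : (1 : ℝ) ≤ q := Nat.one_le_cast.2 hq.one_le
  obtain ⟨t, ht⟩ := ColumnSwap.exists_ringChar_residueField_pow_nsmul_eq_zero R (AddChar R ℂ)
  set w := u.natAbs with hw
  -- For `η ≤ 1`, `(1 + η) ^ 3 ≤ 1 + 7 * η`. The cube pays for counting (`2 * l`) and for the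
  -- hitting bound (`l + w`).
  let η : ℝ := min 1 (ε / 7)
  have hη : 0 < η := lt_min one_pos (by linarith)
  have hη1 : η ≤ 1 := min_le_left _ _
  have hηε : (1 + η) ^ 3 ≤ 1 + ε := by
    have : η ≤ ε / 7 := min_le_right _ _
    nlinarith [mul_le_of_le_one_right hη.le hη1, mul_nonneg hη.le (sub_nonneg.2 hη1),
      mul_nonneg (mul_nonneg hη.le hη.le) (sub_nonneg.2 hη1)]
  obtain ⟨n, hn, hcount⟩ := ColumnSwap.exists_card_offCount_le (AddChar R ℂ) hη hη1
  obtain ⟨δ, hδ0, hδ2, hδ⟩ := ColumnSwap.exists_norm_addChar_add_le (AddChar R ℂ)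
  let ρ : ℝ := max 0 (1 - α * (2 - δ))
  have hρ0 : 0 ≤ ρ := le_max_left _ _
  have hρ1 : ρ < 1 := max_lt one_pos (by nlinarith)
  set a : ℝ := (Fintype.card (AddChar R ℂ) : ℝ) with ha
  have ha1 : 1 ≤ a := Nat.one_le_cast.2 Fintype.card_pos
  obtain ⟨s₀, hs₀⟩ := exists_pow_lt_of_lt_one (show 0 < η / (q * a) by positivity) hρ1
  set κ : ℝ := (Fintype.card (AddSubgroup (AddChar R ℂ)) : ℝ) with hκ
  have hκ0 : 0 ≤ κ := Nat.cast_nonneg _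
  have hD : 0 ≤ κ * ((1 + η) ^ w * a ^ w * q ^ w) := by positivity
  refine ⟨q ^ (n * s₀) + κ * ((1 + η) ^ w * a ^ w * q ^ w),
    fun ξ hξ1 hξ2 hmin l k hlk ν => ?_⟩
  set C : ℝ := q ^ (n * s₀) + κ * ((1 + η) ^ w * a ^ w * q ^ w) with hC
  have hC0 : 0 ≤ C := by positivity
  set β := ColumnSwap.maxBound ξ with hβ_def
  have hβ1 : β ≤ 1 := ColumnSwap.maxBound_le_one ξ
  have hqβ : 1 / (q : ℝ) ≤ β := le_max_left _ _
  have hβ0 : 0 ≤ β := le_trans (by positivity) hqβ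
  have hqβ1 : 1 ≤ q * β := by
    rw [div_le_iff₀ (by positivity)] at hqβ
    linarith
  have hν := ColumnSwap.l1Norm_nonneg ν
  have hε1 : 1 ≤ (1 + ε) ^ l := one_le_pow₀ (by linarith)
  let p : R → ℝ := fun r => (ξ r).toReal
  have hp : ∀ r, 0 ≤ p r := fun r => ENNReal.toReal_nonneg
  have hp1 : ∑ r, p r = 1 := by
    have h := ξ.tsum_coe
    rw [tsum_fintype] at h
    simp only [p]
    rw [← ENNReal.toReal_sum fun r _ => ξ.apply_ne_top r, h, ENNReal.toReal_one]
  have hsupp : ∀ r, r ∈ ξ.support ↔ p r ≠ 0 := fun r => by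
    rw [PMF.mem_support_iff]
    simp [p, ENNReal.toReal_eq_zero_iff, ξ.apply_ne_top r]
  rw [finsum_eq_sum_of_fintype, finsum_eq_sum_of_fintype]
  have hfirst : 0 ≤ ∑ I : Ideal R,
      C * ((1 + ε) ^ l * ColumnSwap.l2Norm (ColumnSwap.modIdeal I ν)) :=
    Finset.sum_nonneg fun I _ => mul_nonneg hC0
      (mul_nonneg (by positivity) (Real.sqrt_nonneg _))
  -- The robustness threshold is `s = l / n`. For small `l` it need not make `ρ ^ s` small, but then
  -- `q ^ (n * s₀) * β ^ l ≥ 1` and contraction is enough.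
  rcases lt_or_ge l (n * s₀) with hsmall | hlarge
  · refine le_trans ?_ (le_add_of_nonneg_left hfirst)
    have h1 : ∑ M : Matrix (Fin l) (Fin k) R, ColumnSwap.iidMatrixProb ξ M *
        ColumnSwap.l1Norm (ColumnSwap.proj (ColumnSwap.matrixImage M) ν) ≤
        ColumnSwap.l1Norm ν := by
      refine (Finset.sum_le_sum fun M _ => mul_le_mul_of_nonneg_left
        (ColumnSwap.l1Norm_proj_le _ ν) (Finset.prod_nonneg fun i _ =>
          Finset.prod_nonneg fun j _ => hp _)).trans (le_of_eq ?_)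
      rw [← Finset.sum_mul]
      have h2 := ColumnSwap.sum_matrix_weight_eq_one hp1 l k
      rw [h2, one_mul]
    refine h1.trans ?_
    have h2 : 1 ≤ q ^ (n * s₀) * β ^ l := by
      calc (1 : ℝ) ≤ (q * β) ^ l := one_le_pow₀ hqβ1
        _ = q ^ l * β ^ l := mul_pow _ _ _
        _ ≤ q ^ (n * s₀) * β ^ l := by
          gcongr ?_ * β ^ l
          exact pow_le_pow_right₀ hq1 hsmall.le
    have h3 : 1 ≤ C * ((1 + ε) ^ l * β ^ l) := by
      calc (1 : ℝ) ≤ q ^ (n * s₀) * β ^ l := h2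
        _ ≤ C * β ^ l := by gcongr; linarith
        _ ≤ C * ((1 + ε) ^ l * β ^ l) := by
          gcongr
          exact le_mul_of_one_le_left (by positivity) hε1
    calc ColumnSwap.l1Norm ν ≤ C * ((1 + ε) ^ l * β ^ l) * ColumnSwap.l1Norm ν :=
          le_mul_of_one_le_left hν h3
      _ = _ := by ring
  · have hs : ρ ^ (l / n) ≤ η / (q * a) := by
      refine le_trans (pow_le_pow_of_le_one hρ0 hρ1.le ?_) hs₀.le
      rw [Nat.le_div_iff_mul_le hn, mul_comm]
      exact hlarge
    have hαp : ∀ r, p r ≠ 0 → α ≤ p r := fun r hr => hmin.2 ⟨r, (hsupp r).2 hr, rfl⟩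
    have hT : ∀ (I : Ideal R) (b : R), I ≠ ⊤ → ¬ ∀ r ∈ {r | p r ≠ 0}, ∃ s ∈ I, r = b + s :=
      fun I b hI h => hξ1 I b hI fun r hr => h r ((hsupp r).1 hr)
    have hT' : ∀ (S : Subring R) (b : R) (c : Rˣ), S ≠ ⊤ →
        ¬ ∀ r ∈ {r | p r ≠ 0}, ∃ s ∈ S, r = b + c * s :=
      fun S b c hS h => hξ2 S b c hS fun r hr => h r ((hsupp r).1 hr)
    have hβx : ∀ x, ∑ r with IsLocalRing.residue R r = x, p r ≤ β := fun x =>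
      (ColumnSwap.sum_fiber_le_residueLinf ξ x).trans (le_max_right _ _)
    have main := ColumnSwap.sum_l1Norm_proj_le_of_bounds hp hp1 hβ0 hβ1 hη.le hqβ1
      (l := l) (k := k) (s := l / n) (w := w) (by omega) (by omega)
      (fun K χ hK => ColumnSwap.hitProb_zero_bounds hp hp1 hT hT' hδ hα.le hαp hρ0 hρ1.le
        (le_max_right _ _) hβx hβ1 hq ht hqβ hη.le hs hK)
      (fun K => hcount l K) ν
    refine le_trans main ?_
    have hηw : 1 ≤ (1 + η) := by linarith
    have h3l : (1 + η) ^ (3 * l) ≤ (1 + ε) ^ l := by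
      rw [pow_mul]
      exact pow_le_pow_left₀ (by positivity) hηε l
    have hl1 : (1 + η) ^ l ≤ (1 + ε) ^ l :=
      (pow_le_pow_right₀ hηw (by omega)).trans h3l
    have hDC : κ * ((1 + η) ^ w * a ^ w * q ^ w) ≤ C := by
      rw [hC]
      exact le_add_of_nonneg_left (by positivity)
    have hL : 0 ≤ ∑ I : Ideal R, ColumnSwap.l2Norm (ColumnSwap.modIdeal I ν) :=
      Finset.sum_nonneg fun I _ => Real.sqrt_nonneg _
    refine add_le_add ?_ ?_
    · rw [← Finset.mul_sum, ← Finset.mul_sum, ← ha, ← hκ]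
      set L := ∑ I : Ideal R, ColumnSwap.l2Norm (ColumnSwap.modIdeal I ν)
      calc κ * ((1 + η) ^ (l + w) * a ^ w * L)
          = κ * ((1 + η) ^ w * a ^ w) * ((1 + η) ^ l * L) := by rw [pow_add]; ring
        _ ≤ κ * ((1 + η) ^ w * a ^ w * q ^ w) * ((1 + ε) ^ l * L) := by
          gcongr ?_ * (?_ * L)
          gcongr κ * ?_
          exact le_mul_of_one_le_right (by positivity) (one_le_pow₀ hq1)
        _ ≤ C * ((1 + ε) ^ l * L) := by gcongr
    · rw [← ha, ← hκ]
      set L := ColumnSwap.l1Norm ν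
      calc κ * ((1 + η) ^ (3 * l + w) * a ^ w * q ^ w * β ^ l) * L
          = κ * ((1 + η) ^ w * a ^ w * q ^ w) * ((1 + η) ^ (3 * l) * β ^ l * L) := by
            rw [pow_add]; ring
        _ ≤ C * ((1 + ε) ^ l * β ^ l * L) := by gcongr
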